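/- **Voronoi Cell Decomposition Theorem.** Let $S\subseteq\mathbb R^2$ be a finite non-empty set no four of whose points lie on a common circle. The Delaunay triangulation $D$ of $S$ consists of all non-degenerate triangles spanned by three points of $S$ such that no point of $S$ lies strictly inside the circumcircle of the triangle. For an acute triangle $\Delta$ put $V(\Delta)=\int_\Delta \min_{v}|x-v|^2\,dx$, where $v$ ranges over the three vertices of $\Delta$; for every other triangle put $V(\Delta)=\frac{\operatorname{area}(\Delta)}{12}(a^2+b^2+c^2-4R^2)$, where $a,b,c$ are the side lengths and $R$ is the circumradius of $\Delta$. Let $V(D)=\sum_{\Delta\in D}V(\Delta)$. By a vertex of $\operatorname{conv} S$ we mean a point of $S$ on the boundary of $\operatorname{conv} S$ (these are the extreme points if no point of $S$ lies in the relative interior of a side of the hull). A vertex $v$ is visible from $x\notin\operatorname{conv} S$ if the segment from $x$ to $v$ meets $\operatorname{conv} S$ only in $v$. Let $N_S(x)$ be a point of $S$ nearest to $x$, and, for $x\notin\operatorname{conv}S$, let $NV_S(x)$ be a visible vertex of $\operatorname{conv} S$ nearest to $x$ (such vertices exist); for $x\in\operatorname{conv} S$ set $|x-NV_S(x)|^2=0$.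 Then the function $x\mapsto |x-N_S(x)|^2-|x-NV_S(x)|^2$ is integrable on $\mathbb R^2$ and $$V(D)=\int_{\mathbb R^2}\bigl(|x-N_S(x)|^2-|x-NV_S(x)|^2\bigr)\,dx .$$ If, moreover, for every triangle of $D$ and every edge of it contained in the boundary of $\operatorname{conv} S$, the angle of the triangle opposite to that edge is acute, then $$V(D)=\int_{\operatorname{conv} S}|x-N_S(x)|^2\,dx .$$ -/

import Mathlib

open MeasureTheory EuclideanGeometry

noncomputable section

namespace VoronoiFunctional

/-- The Euclidean plane `ℝ²`, with its Euclidean distance and Lebesgue measure. -/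
abbrev Plane : Type := EuclideanSpace ℝ (Fin 2)

/-- The convex hull of the vertices of a triangle. -/
def body (T : Affine.Triangle ℝ Plane) : Set Plane :=
  convexHull ℝ (Set.range T.points)

/-- The Voronoi functional of a (non-degenerate) triangle `Δ`.  If `Δ` is acute, it is the integral
over `Δ` of the squared distance to the nearest of the three vertices (`Metric.infDist` to the
vertex set).  Otherwise it is `area(Δ) / 12 * (a² + b² + c² - 4 R²)`, where `a`, `b`, `c` are the
side lengths and `R` is the circumradius. -/
def voronoiTriangle (T : Affine.Triangle ℝ Plane) : ℝ :=
  open Classical in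
  if T.AcuteAngled then
    ∫ x in body T, Metric.infDist x (Set.range T.points) ^ 2
  else
    volume.real (body T) / 12 *
      (dist (T.points 1) (T.points 2) ^ 2 + dist (T.points 2) (T.points 0) ^ 2
        + dist (T.points 0) (T.points 1) ^ 2 - 4 * T.circumradius ^ 2)

/-- The Voronoi functional of a triangle does not depend on the order of its vertices. -/
theorem voronoiTriangle_eq_of_range_eq (T T' : Affine.Triangle ℝ Plane)
    (h : Set.range T.points = Set.range T'.points) : voronoiTriangle T = voronoiTriangle T' := by
  have hex : ∀ i, ∃ j, T.points j = T'.points i := fun i => by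
    have : T'.points i ∈ Set.range T.points := h ▸ Set.mem_range_self i
    exact this
  choose f hf using hex
  have hinj : Function.Injective f := fun i j hij => by
    apply T'.independent.injective
    rw [← hf i, ← hf j, hij]
  let e : Fin 3 ≃ Fin 3 := Equiv.ofBijective f (Finite.injective_iff_bijective.mp hinj)
  have hT' : T' = T.reindex e.symm := by
    ext1 i
    simp only [Affine.Simplex.reindex_points, Function.comp_apply, Equiv.symm_symm]
    exact (hf i).symm
  have hacute : T'.AcuteAngled ↔ T.AcuteAngled := by
    rw [hT']; exact Affine.Simplex.acuteAngled_reindex_iff _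
  have hR : T'.circumradius = T.circumradius := by
    rw [hT']; exact Affine.Simplex.circumradius_reindex _ _
  have hsum : ∀ U : Affine.Triangle ℝ Plane,
      dist (U.points 1) (U.points 2) ^ 2 + dist (U.points 2) (U.points 0) ^ 2
        + dist (U.points 0) (U.points 1) ^ 2
      = (∑ i : Fin 3, ∑ j : Fin 3, dist (U.points i) (U.points j) ^ 2) / 2 := fun U => by
    simp only [Fin.sum_univ_three, dist_self]
    rw [dist_comm (U.points 1) (U.points 0), dist_comm (U.points 2) (U.points 1),
      dist_comm (U.points 2) (U.points 0)]
    ring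
  have hdbl : (∑ i : Fin 3, ∑ j : Fin 3, dist (T'.points i) (T'.points j) ^ 2)
      = ∑ i : Fin 3, ∑ j : Fin 3, dist (T.points i) (T.points j) ^ 2 := by
    have hpt : ∀ i, T'.points i = T.points (e i) := fun i => (hf i).symm
    simp only [hpt]
    rw [← Equiv.sum_comp e (fun i => ∑ j, dist (T.points i) (T.points j) ^ 2)]
    refine Finset.sum_congr rfl fun i _ => ?_
    exact Equiv.sum_comp e (fun j => dist (T.points (e i)) (T.points j) ^ 2)
  unfold voronoiTriangle body
  rw [hsum T, hsum T', hdbl, hR, h]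
  by_cases ha : T.AcuteAngled
  · rw [if_pos ha, if_pos (hacute.mpr ha)]
  · rw [if_neg ha, if_neg (fun h' => ha (hacute.mp h'))]

/-- The Voronoi functional of the triangle with vertex set `t`
(`0` if `t` is not the vertex set of a triangle). -/
def voronoiVertexSet (t : Finset Plane) : ℝ :=
  open Classical in
  if h : ∃ T : Affine.Triangle ℝ Plane, Set.range T.points = (t : Set Plane) then
    voronoiTriangle h.choose
  else 0

/-- `T` is a Delaunay triangle of `S`: its vertices belong to `S`, and no point of `S` is enclosed
by its circumcircle. -/
def IsDelaunay (S : Finset Plane) (T : Affine.Triangle ℝ Plane) : Prop :=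
  (∀ i, T.points i ∈ S) ∧ ∀ p ∈ S, T.circumradius ≤ dist p T.circumcenter

/-- The triangles of the Delaunay triangulation of `S`, each given by its vertex set. -/
def delaunay (S : Finset Plane) : Finset (Finset Plane) :=
  open Classical in
  S.powerset.filter fun t =>
    ∃ T : Affine.Triangle ℝ Plane, IsDelaunay S T ∧ Set.range T.points = (t : Set Plane)

/-- The Voronoi functional of a triangulation is the sum over its triangles. -/
def voronoi (K : Finset (Finset Plane)) : ℝ :=
  ∑ t ∈ K, voronoiVertexSet t

/-- General position: no four points of `S` lie on a common circle. -/
def GeneralPosition (S : Finset Plane) : Prop :=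
  ∀ t ⊆ S, t.card = 4 → ¬ Cospherical (t : Set Plane)

/-- The convex hull of `S`. -/
def hull (S : Finset Plane) : Set Plane :=
  convexHull ℝ (S : Set Plane)

/-- The vertices of `conv S`: the points of `S` on the boundary of `conv S`.  Points of `S` in the
relative interior of a side of the hull count as vertices (they are vertices of the boundary of
every triangulation of `S`); if there are none, these are exactly the extreme points. -/
def hullVertices (S : Finset Plane) : Set Plane :=
  {v | v ∈ S ∧ v ∈ frontier (hull S)}

/-- The vertices of `conv S` visible from `x`: those `v` for which the segment from `x` to `v`
meets `conv S` only in `v`. -/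
def visibleVertices (S : Finset Plane) (x : Plane) : Set Plane :=
  {v | v ∈ hullVertices S ∧ segment ℝ x v ∩ hull S = {v}}

/-- `p` is a nearest point to `x` in the set `A`. -/
def IsNearest (A : Set Plane) (x p : Plane) : Prop :=
  p ∈ A ∧ ∀ q ∈ A, dist x p ≤ dist x q

/-- In the Delaunay triangulation of `S`, all angles opposite to edges of the convex hull are
acute. -/
def HullOppositeAnglesAcute (S : Finset Plane) : Prop :=
  ∀ T : Affine.Triangle ℝ Plane, IsDelaunay S T →
    ∀ i j k : Fin 3, i ≠ j → i ≠ k → j ≠ k →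
      segment ℝ (T.points i) (T.points j) ⊆ frontier (hull S) →
        ∠ (T.points i) (T.points k) (T.points j) < Real.pi / 2

open Classical in
/-- The function `x ↦ |x - N(x)|² - |x - NV(x)|²`, where the second term is `0` for `x` in
`conv S`. -/
def cellIntegrand (S : Finset Plane) (N NV : Plane → Plane) (x : Plane) : ℝ :=
  dist x (N x) ^ 2 - if x ∈ hull S then 0 else dist x (NV x) ^ 2

end VoronoiFunctional

end

noncomputable section

namespace VoronoiFunctional

open Set

/-! Fix `v ∈ S` and a generic `x`. If `x` lies in the Voronoi cell of `v`, the ray from `v` through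
`x` either stays in the cell forever, or leaves it through the Voronoi edge shared with exactly one
`w` (`sum_exitsThrough`). Staying forever means that `x` lies in the normal cone of the hull at `v`.
A generic `x` outside the hull either lies in exactly one normal cone, or projects into the relative
interior of a hull edge, into the half nearer to one end `v`; in both cases `v` is the nearest
visible vertex (`sum_faces`). The normal cones cancel in the difference, and the integrand becomes a
sum over ordered pairs `(v, w)` of `|x - v|² ([ExitsThrough] - [ProjectsNear])`.

For fixed `(v, w)` both conditions confine `x` to the strip between `v` and the bisector. They
depend otherwise only on the parameter `t` at which the ray meets the bisector: the first says that
`t` lies on the Voronoi edge, the second that this edge is unbounded in the direction of `t`. A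
one-dimensional polyhedron minus the half-lines at its infinite ends is a sum of signed intervals
from `0` to its finite ends (`sum_signedInterval`), and these ends are circumcenters of Delaunay
triangles. So the integrand is a finite signed sum of flags, right triangles with vertices `v`, `(v
+ w) / 2` and a circumcenter (`pair_eq_flags`). Flags are bounded, which gives integrability, and
their integrals are explicit (`integral_flag`).

Each Delaunay triangle receives six flags, whose integrals add up to the closed formula by an
algebraic identity (`closed_formula`). For an acute triangle, whose functional is defined by an
integral, the argument is applied to its three vertices alone (`voronoiTriangle_eq_of_acute`). If
the angles opposite to hull edges are acute, the circles with hull edges as diameters contain no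
point of `S` in their interior, so the two distances agree outside the hull and only the integral
over the hull survives. -/

/-! ### Coordinates, affine changes of variables and null lines. -/

/-- The inner product of `p - o` and `q - o`. -/
def dp (o p q : Plane) : ℝ := (p 0 - o 0) * (q 0 - o 0) + (p 1 - o 1) * (q 1 - o 1)

/-- The cross product of `p - o` and `q - o`. -/
def cp (o p q : Plane) : ℝ := (p 0 - o 0) * (q 1 - o 1) - (p 1 - o 1) * (q 0 - o 0)

theorem dist_sq_eq (x y : Plane) : dist x y ^ 2 = dp y x x := by
  rw [EuclideanSpace.dist_eq, Real.sq_sqrt (by positivity)]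
  simp only [Fin.sum_univ_two, Real.dist_eq, sq_abs, dp]
  ring

theorem dist_le_dist_iff (x p q : Plane) : dist x p ≤ dist x q ↔ dp p x x ≤ dp q x x := by
  rw [← dist_sq_eq, ← dist_sq_eq]
  exact (sq_le_sq₀ dist_nonneg dist_nonneg).symm

theorem dp_self_nonneg (o p : Plane) : 0 ≤ dp o p p := by
  unfold dp; nlinarith [mul_self_nonneg (p 0 - o 0), mul_self_nonneg (p 1 - o 1)]

theorem eq_of_dp_self_le {o p : Plane} (h : dp o p p ≤ 0) : p = o := by
  unfold dp at h
  have h0 : p 0 - o 0 = 0 := by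
    nlinarith [mul_self_nonneg (p 0 - o 0), mul_self_nonneg (p 1 - o 1)]
  have h1 : p 1 - o 1 = 0 := by
    nlinarith [mul_self_nonneg (p 0 - o 0), mul_self_nonneg (p 1 - o 1)]
  ext i
  fin_cases i
  · exact sub_eq_zero.mp h0
  · exact sub_eq_zero.mp h1

theorem dp_self_pos {o p : Plane} (h : p ≠ o) : 0 < dp o p p := by
  by_contra! h'
  exact h (eq_of_dp_self_le h')

theorem dp_sq_add_cp_sq (v w x : Plane) :
    dp v w x ^ 2 + cp v w x ^ 2 = dp v w w * dp v x x := by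
  unfold dp cp; ring

theorem measurable_dp (v w : Plane) : Measurable (dp v w) := by unfold dp; fun_prop

theorem measurable_cp (v w : Plane) : Measurable (cp v w) := by unfold cp; fun_prop

/-- The push-forward of Lebesgue measure under an invertible affine map to `ℝ × ℝ`. -/
theorem map_affine_volume (v : Plane) (a b c d : ℝ) (hdet : a * d - b * c ≠ 0) :
    Measure.map (fun x : Plane => (a * (x 0 - v 0) + b * (x 1 - v 1),
      c * (x 0 - v 0) + d * (x 1 - v 1))) volume
      = ENNReal.ofReal |(a * d - b * c)⁻¹| • (volume : Measure (ℝ × ℝ)) := by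
  have hdetM : (!![a, b; c, d]).det = a * d - b * c := by rw [Matrix.det_fin_two_of]
  have h1 : MeasurePreserving (fun x : Plane => x - v) volume volume :=
    measurePreserving_sub_right volume v
  have h2 := PiLp.volume_preserving_ofLp (Fin 2)
  have h3 := Real.map_matrix_volume_pi_eq_smul_volume_pi (M := !![a, b; c, d])
    (by rw [hdetM]; exact hdet)
  have h4 := volume_preserving_finTwoArrow ℝ
  have hm : Measurable (Matrix.toLin' !![a, b; c, d]) :=
    (LinearMap.continuous_of_finiteDimensional _).measurable
  have key : (fun x : Plane => (a * (x 0 - v 0) + b * (x 1 - v 1),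
      c * (x 0 - v 0) + d * (x 1 - v 1)))
      = (MeasurableEquiv.finTwoArrow ∘ (Matrix.toLin' !![a, b; c, d])) ∘
        (fun x : Plane => (WithLp.ofLp (x - v) : Fin 2 → ℝ)) := by
    funext x
    simp [MeasurableEquiv.finTwoArrow, Matrix.mulVec, dotProduct, Fin.sum_univ_two]
  have h12 : Measure.map (fun x : Plane => (WithLp.ofLp (x - v) : Fin 2 → ℝ)) volume = volume :=
    (h2.comp h1).map_eq
  rw [key, ← Measure.map_map (h4.measurable.comp hm) (by exact (h2.comp h1).measurable), h12,
    ← Measure.map_map h4.measurable hm, h3, Measure.map_smul, h4.map_eq, hdetM]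

theorem map_dp_cp_volume {v w : Plane} (h : w ≠ v) :
    Measure.map (fun x : Plane => (dp v w x, cp v w x)) volume
      = ENNReal.ofReal (dp v w w)⁻¹ • (volume : Measure (ℝ × ℝ)) := by
  have hc := dp_self_pos h
  have e : (w 0 - v 0) * (w 0 - v 0) - (w 1 - v 1) * (-(w 1 - v 1)) = dp v w w := by
    unfold dp; ring
  have := map_affine_volume v (w 0 - v 0) (w 1 - v 1) (-(w 1 - v 1)) (w 0 - v 0)
    (by rw [e]; exact hc.ne')
  rw [e, abs_of_pos (inv_pos.mpr hc)] at this
  rw [← this]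
  congr 1
  funext x
  simp only [dp, cp, Prod.mk.injEq, true_and]
  ring

/-- A line is a null set. -/
theorem ae_linear_ne (a b k : ℝ) (h : a ≠ 0 ∨ b ≠ 0) :
    ∀ᵐ x : Plane, a * x 0 + b * x 1 ≠ k := by
  -- The linear form is completed to a scaled rotation, of determinant `a² + b²`.
  have hd : a * a - b * (-b) ≠ 0 := by
    rcases h with h | h
    · have := mul_self_pos.mpr h
      nlinarith [mul_self_nonneg b]
    · have := mul_self_pos.mpr h
      nlinarith [mul_self_nonneg a]
  have hmap := map_affine_volume 0 a b (-b) a hd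
  have hae : ∀ᵐ y : ℝ × ℝ, y.1 ≠ k := by
    have : (volume : Measure (ℝ × ℝ)) {y | ¬ y.1 ≠ k} = 0 := by
      have hs : {y : ℝ × ℝ | ¬ y.1 ≠ k} = ({k} : Set ℝ) ×ˢ (univ : Set ℝ) := by
        ext y; simp
      rw [hs, Measure.volume_eq_prod, Measure.prod_prod]
      simp
    exact this
  have h2 : ∀ᵐ y ∂(ENNReal.ofReal |(a * a - b * (-b))⁻¹| • (volume : Measure (ℝ × ℝ))), y.1 ≠ k :=
    Measure.ae_smul_measure hae _
  rw [← hmap] at h2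
  have h3 := ae_of_ae_map (Measurable.aemeasurable (by fun_prop)) h2
  filter_upwards [h3] with x hx
  simpa using hx

theorem ae_ne (p : Plane) : ∀ᵐ x : Plane, x ≠ p := by
  filter_upwards [ae_linear_ne 1 0 (p 0) (by simp)] with x hx hxp
  exact hx (by rw [hxp]; simp)

/-! ### Signed intervals and the integral over a flag. -/

/-- The signed indicator function of the interval between `0` and `s`. -/
def signedInterval (s t : ℝ) : ℝ :=
  (Ioc 0 s).indicator (fun _ => 1) t - (Ioc s 0).indicator (fun _ => 1) t

/-- The antiderivative of `1 + 4 t²` vanishing at `0`. -/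
def cubic (s : ℝ) : ℝ := s + 4 * s ^ 3 / 3

theorem signedInterval_of_le {s t : ℝ} (h : |s| < |t|) : signedInterval s t = 0 := by
  have h1 : t ∉ Ioc 0 s := fun ht => by
    rw [abs_of_pos ht.1] at h
    exact absurd (h.trans_le' (le_abs_self s)) (not_lt.mpr ht.2)
  have h2 : t ∉ Ioc s 0 := fun ht => by
    rw [abs_of_nonpos ht.2, abs_of_neg (ht.1.trans_le ht.2)] at h
    linarith [ht.1]
  simp [signedInterval, indicator_of_notMem h1, indicator_of_notMem h2]

theorem abs_signedInterval_le (s t : ℝ) : |signedInterval s t| ≤ 1 := by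
  unfold signedInterval indicator
  split_ifs <;> norm_num

@[fun_prop]
theorem measurable_signedInterval (s : ℝ) : Measurable (signedInterval s) :=
  (measurable_const.indicator measurableSet_Ioc).sub (measurable_const.indicator measurableSet_Ioc)

theorem integral_signedInterval (s : ℝ) :
    ∫ t, signedInterval s t * (1 + 4 * t ^ 2) = cubic s := by
  have hc : Continuous fun t : ℝ => 1 + 4 * t ^ 2 := by fun_prop
  have h1 : ∫ t in (0 : ℝ)..s, (1 + 4 * t ^ 2) = cubic s := by
    have : ∀ t ∈ uIcc 0 s, HasDerivAt cubic (1 + 4 * t ^ 2) t := fun t _ => by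
      have := (hasDerivAt_id t).add (((hasDerivAt_pow 3 t).const_mul (4 : ℝ)).div_const 3)
      exact this.congr_deriv (by push_cast; ring)
    rw [intervalIntegral.integral_eq_sub_of_hasDerivAt this (hc.intervalIntegrable _ _)]
    simp [cubic]
  rw [← h1, intervalIntegral.intervalIntegral_eq_integral_uIoc]
  have hfun : ∀ t : ℝ, signedInterval s t * (1 + 4 * t ^ 2)
      = (Ioc 0 s).indicator (fun t => 1 + 4 * t ^ 2) t
        - (Ioc s 0).indicator (fun t => 1 + 4 * t ^ 2) t := fun t => by
    unfold signedInterval indicator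
    split_ifs <;> simp
  simp only [hfun]
  rw [integral_sub, integral_indicator measurableSet_Ioc, integral_indicator measurableSet_Ioc]
  · split_ifs with h
    · simp [uIoc_of_le h, Ioc_eq_empty_of_le h]
    · have h' : s ≤ 0 := by linarith
      simp [uIoc_of_ge h', Ioc_eq_empty_of_le h']
  · exact (hc.integrableOn_Ioc).integrable_indicator measurableSet_Ioc
  · exact (hc.integrableOn_Ioc).integrable_indicator measurableSet_Ioc

/-- The density of the signed right triangle with vertex `v`, leg `[v, (v + w) / 2]` and hypotenuse
ending at distance `s * |w - v|` from `(v + w) / 2` on the perpendicular bisector, in terms of the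
inner and cross product of `x - v` and `w - v`, where `c = |w - v|²`. -/
def flagDensity (c s : ℝ) (y : ℝ × ℝ) : ℝ :=
  (Ioo 0 (c / 2)).indicator
    (fun a => signedInterval s (y.2 / (2 * a)) * ((a ^ 2 + y.2 ^ 2) / c)) y.1

theorem measurable_flagDensity (c s : ℝ) : Measurable (flagDensity c s) := by
  have : flagDensity c s = (Prod.fst ⁻¹' Ioo 0 (c / 2)).indicator
      (fun y : ℝ × ℝ => signedInterval s (y.2 / (2 * y.1)) * ((y.1 ^ 2 + y.2 ^ 2) / c)) := by
    funext y
    simp [flagDensity, indicator]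
  rw [this]
  refine Measurable.indicator ?_ (measurable_fst measurableSet_Ioo)
  exact ((measurable_signedInterval s).comp (by fun_prop)).mul (by fun_prop)

/-- The density is bounded with bounded support: `|b / (2 a)| ≤ |s|` and `a < c / 2` force `|b| ≤ c
|s|`. -/
theorem integrable_flagDensity {c : ℝ} (hc : 0 < c) (s : ℝ) : Integrable (flagDensity c s) := by
  set B : Set (ℝ × ℝ) := Ioo 0 (c / 2) ×ˢ Icc (-(c * |s|)) (c * |s|) with hB
  have hBm : MeasurableSet B := measurableSet_Ioo.prod measurableSet_Icc
  have hsupp : ∀ y, flagDensity c s y ≠ 0 → y ∈ B := fun y hy => by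
    unfold flagDensity at hy
    have hy1 : y.1 ∈ Ioo 0 (c / 2) := mem_of_indicator_ne_zero hy
    rw [indicator_of_mem hy1] at hy
    have h1 : |y.2 / (2 * y.1)| ≤ |s| := by
      by_contra! h
      exact hy (by rw [signedInterval_of_le h, zero_mul])
    have hp : 0 < 2 * y.1 := by linarith [hy1.1]
    rw [abs_div, abs_of_pos hp, div_le_iff₀ hp] at h1
    have h2 : |y.2| ≤ c * |s| := by nlinarith [hy1.2, abs_nonneg s]
    exact ⟨hy1, abs_le.mp h2⟩
  have heq : flagDensity c s = B.indicator (flagDensity c s) := by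
    funext y
    by_cases hy : y ∈ B
    · rw [indicator_of_mem hy]
    · rw [indicator_of_notMem hy]
      by_contra h
      exact hy (hsupp y h)
  rw [heq]
  refine IntegrableOn.integrable_indicator ?_ hBm
  refine Measure.integrableOn_of_bounded (M := ((c / 2) ^ 2 + (c * |s|) ^ 2) / c) ?_
    (measurable_flagDensity c s).aestronglyMeasurable ?_
  · rw [Measure.volume_eq_prod, hB, Measure.prod_prod]
    exact (ENNReal.mul_lt_top measure_Ioo_lt_top measure_Icc_lt_top).ne
  · filter_upwards [ae_restrict_mem hBm] with y hy
    unfold flagDensity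
    rw [indicator_of_mem hy.1, norm_mul, Real.norm_eq_abs, Real.norm_eq_abs,
      abs_of_nonneg (a := (y.1 ^ 2 + y.2 ^ 2) / c) (by positivity)]
    have h1 : y.1 ^ 2 ≤ (c / 2) ^ 2 := by
      have := hy.1.1; have := hy.1.2; gcongr
    have h2 : y.2 ^ 2 ≤ (c * |s|) ^ 2 := sq_le_sq' hy.2.1 hy.2.2
    calc _ ≤ 1 * ((y.1 ^ 2 + y.2 ^ 2) / c) := by
          gcongr; exact abs_signedInterval_le _ _
      _ ≤ _ := by rw [one_mul]; gcongr

/-- For fixed `a`, the substitution `b = 2 a t` turns the density into `(a² / c) (1 + 4 t²)` on the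
signed interval, so the slice contributes `2 a³ / c * cubic s`. -/
theorem integral_flagDensity {c : ℝ} (hc : 0 < c) (s : ℝ) :
    ∫ y, flagDensity c s y = c ^ 3 / 32 * cubic s := by
  have hint := integrable_flagDensity hc s
  rw [Measure.volume_eq_prod] at hint ⊢
  rw [integral_prod _ hint]
  have hinner : ∀ a : ℝ, ∫ b, flagDensity c s (a, b)
      = (Ioc 0 (c / 2)).indicator (fun a => 2 * a ^ 3 / c * cubic s) a
        -- The singleton term corrects the passage from `Ioo` to the `Ioc` of interval integrals; it
        -- is null.
        - ({c / 2} : Set ℝ).indicator (fun a => 2 * a ^ 3 / c * cubic s) a := fun a => by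
    by_cases ha : a ∈ Ioo 0 (c / 2)
    · have h1 : ∀ b, flagDensity c s (a, b)
          = (fun t => a ^ 2 / c * (signedInterval s t * (1 + 4 * t ^ 2))) (b / (2 * a)) :=
        fun b => by
          have ha0 : a ≠ 0 := ha.1.ne'
          simp only [flagDensity, indicator_of_mem ha]
          field_simp
          ring
      rw [integral_congr_ae (Filter.Eventually.of_forall h1),
        Measure.integral_comp_div (fun t => a ^ 2 / c * (signedInterval s t * (1 + 4 * t ^ 2))), integral_const_mul, integral_signedInterval,
        indicator_of_mem (Ioo_subset_Ioc_self ha), indicator_of_notMem (by simpa using ha.2.ne),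
        abs_of_pos (by linarith [ha.1]), smul_eq_mul]
      ring
    · simp only [flagDensity, indicator_of_notMem ha, integral_zero]
      by_cases hac : a = c / 2
      · subst hac
        simp [indicator, hc]
      · have : a ∉ Ioc 0 (c / 2) := fun h => ha ⟨h.1, lt_of_le_of_ne h.2 hac⟩
        simp [indicator_of_notMem this, hac]
  simp only [hinner]
  have hnull : (({c / 2} : Set ℝ).indicator (fun a => 2 * a ^ 3 / c * cubic s)) =ᵐ[volume] 0 :=
    indicator_meas_zero (by simp)
  rw [integral_sub, integral_congr_ae hnull, integral_indicator measurableSet_Ioc,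
    ← intervalIntegral.integral_of_le (by linarith)]
  · have : ∀ a : ℝ, 2 * a ^ 3 / c * cubic s = (2 / c * cubic s) * a ^ 3 := fun a => by ring
    simp only [this, intervalIntegral.integral_const_mul, integral_pow]
    simp
    field_simp
    ring
  · refine IntegrableOn.integrable_indicator ?_ measurableSet_Ioc
    exact Continuous.integrableOn_Ioc (by fun_prop)
  · exact (integrable_congr hnull).mpr (integrable_zero _ _ _)

/-- The squared distance to `v`, multiplied by the signed indicator function of the right triangle
with legs from `(v + w) / 2` to `v` and to the point of the perpendicular bisector with
parameter `s`. -/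
def flag (v w : Plane) (s : ℝ) (x : Plane) : ℝ := flagDensity (dp v w w) s (dp v w x, cp v w x)

theorem measurable_dp_cp (v w : Plane) : Measurable fun x : Plane => (dp v w x, cp v w x) :=
  (measurable_dp v w).prodMk (measurable_cp v w)

theorem integrable_flag {v w : Plane} (h : w ≠ v) (s : ℝ) : Integrable (flag v w s) := by
  have := (integrable_flagDensity (dp_self_pos h) s).smul_measure
    (ENNReal.ofReal_ne_top (r := (dp v w w)⁻¹))
  rw [← map_dp_cp_volume h] at this
  exact this.comp_measurable (measurable_dp_cp v w)

theorem integral_flag {v w : Plane} (h : w ≠ v) (s : ℝ) :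
    ∫ x, flag v w s x = dp v w w ^ 2 / 32 * cubic s := by
  have hc := dp_self_pos h
  have := integral_map (measurable_dp_cp v w).aemeasurable
    (measurable_flagDensity (dp v w w) s).aestronglyMeasurable (μ := volume)
  unfold flag
  rw [← this, map_dp_cp_volume h, integral_smul_measure, integral_flagDensity hc,
    ENNReal.toReal_ofReal (inv_pos.mpr hc).le, smul_eq_mul]
  field_simp

/-! ### Polyhedra on the real line as sums of signed intervals. -/

open Classical in
theorem signedInterval_eq {s t : ℝ} (ht : t ≠ 0) :
    signedInterval s t = (if t ≤ s then 1 else 0) - (if t < 0 then 1 else 0) := by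
  unfold signedInterval indicator
  simp only [mem_Ioc]
  rcases lt_or_gt_of_ne ht with h | h
  · by_cases hs : t ≤ s
    · simp [h, hs, h.not_gt, hs.not_gt]
    · simp [h, hs, h.not_gt, h.le, not_le.mp hs]
  · by_cases hs : t ≤ s <;> simp [h, hs, h.not_gt, h.not_ge]

theorem signedInterval_neg {s t : ℝ} (ht : t ≠ 0) (hts : t ≠ s) :
    signedInterval (-s) (-t) = - signedInterval s t := by
  rw [signedInterval_eq ht, signedInterval_eq (neg_ne_zero.mpr ht)]
  simp only [neg_le_neg_iff, Left.neg_neg_iff]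
  rcases lt_or_gt_of_ne ht with h | h <;> rcases lt_or_gt_of_ne hts with h' | h' <;>
    simp [h, h.not_gt, h'.le, h'.not_ge]

section Halflines

variable {ι : Type*} (J : Finset ι) (β γ : ι → ℝ)

/-- The real number `t` satisfies all the inequalities `β j * t ≤ γ j`. -/
def Feasible (t : ℝ) : Prop := ∀ j ∈ J, β j * t ≤ γ j

/-- The inequalities `β j * t ≤ γ j` hold for all sufficiently large `t`. -/
def FeasibleAtTop : Prop := ∀ j ∈ J, β j ≤ 0 ∧ (β j = 0 → 0 ≤ γ j)

variable {J β γ}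

theorem FeasibleAtTop.exists_feasible (h : FeasibleAtTop J β γ) : ∃ t, Feasible J β γ t := by
  have : ∀ᶠ t in Filter.atTop, ∀ j ∈ J, β j * t ≤ γ j := by
    rw [Filter.eventually_all_finset]
    intro j hj
    rcases (h j hj).1.lt_or_eq with hb | hb
    · filter_upwards [Filter.eventually_ge_atTop (γ j / β j)] with t ht
      rwa [div_le_iff_of_neg hb, mul_comm] at ht
    · filter_upwards with t
      rw [hb, zero_mul]
      exact (h j hj).2 hb
  exact this.exists

theorem feasible_neg_iff (t : ℝ) : Feasible J (fun j => -β j) γ (-t) ↔ Feasible J β γ t := by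
  simp [Feasible]

open Classical in
-- The least ratio `γ / β` over the positive `β` is the upper end of the polyhedron, and by
-- uniqueness the only summand. Without positive `β` there is no upper end and both sides vanish.
theorem sum_signedInterval_upper
    (huniq : ∀ i ∈ J, ∀ j ∈ J, 0 < β i → 0 < β j → Feasible J β γ (γ i / β i) →
      Feasible J β γ (γ j / β j) → i = j)
    (hne : ∃ s, Feasible J β γ s) {t : ℝ} (ht : t ≠ 0) :
    ∑ u ∈ J with 0 < β u ∧ Feasible J β γ (γ u / β u), signedInterval (γ u / β u) t
      = (if ∀ j ∈ J, 0 < β j → β j * t ≤ γ j then 1 else 0)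
        - (if (∀ j ∈ J, β j ≤ 0) ∨ t < 0 then 1 else 0) := by
  obtain ⟨s, hs⟩ := hne
  by_cases hpos : ∀ j ∈ J, β j ≤ 0
  · rw [Finset.sum_eq_zero, if_pos (fun j hj hb => absurd hb (hpos j hj).not_gt),
      if_pos (Or.inl hpos), sub_self]
    intro u hu
    rw [Finset.mem_filter] at hu
    exact absurd hu.2.1 (hpos u hu.1).not_gt
  · have hP : (J.filter fun j => 0 < β j).Nonempty := by
      push Not at hpos
      obtain ⟨j, hj, hb⟩ := hpos
      exact ⟨j, by simp [hj, hb]⟩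
    obtain ⟨u, hu, hmin⟩ := Finset.exists_min_image _ (fun j => γ j / β j) hP
    rw [Finset.mem_filter] at hu
    have hmin' : ∀ j ∈ J, 0 < β j → β j * (γ u / β u) ≤ γ j := fun j hj hb => by
      have := hmin j (by simp [hj, hb])
      rwa [le_div_iff₀ hb, mul_comm] at this
    -- The remaining constraints are lower bounds; they hold at the feasible `s`, hence at the
    -- larger upper end.
    have hfeas : Feasible J β γ (γ u / β u) := fun j hj => by
      rcases lt_or_ge 0 (β j) with hb | hb
      · exact hmin' j hj hb
      · have h1 : s ≤ γ u / β u := by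
          rw [le_div_iff₀ hu.2, mul_comm]
          exact hs u hu.1
        exact (mul_le_mul_of_nonpos_left h1 hb).trans (hs j hj)
    rw [Finset.sum_eq_single_of_mem u (by simp [hu, hfeas])]
    · rw [signedInterval_eq ht]
      simp only [hpos, false_or]
      congr 1
      refine if_congr ⟨fun h j hj hb => ?_, fun h => ?_⟩ rfl rfl
      · exact (mul_le_mul_of_nonneg_left h hb.le).trans (hmin' j hj hb)
      · rw [le_div_iff₀ hu.2, mul_comm]
        exact h u hu.1 hu.2
    · intro j hj hju
      rw [Finset.mem_filter] at hj
      exact absurd (huniq j hj.1 u hu.1 hj.2.1 hu.2 hj.2.2 hfeas) hju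

/-- Inclusion–exclusion: `[A ∧ B] = [A] + [B] - 1` when `A ∨ B`, and for `t ≠ 0` the constant `1`
splits as `[t < 0] + [-t < 0]`, one half-line for each end. -/
theorem ite_identity {A B C D : Prop} {t : ℝ} {_ : Decidable A} {_ : Decidable B}
    {_ : Decidable (A ∧ B)} {_ : Decidable (C ∧ 0 < t ∨ D ∧ t < 0)} {_ : Decidable (C ∨ t < 0)}
    {_ : Decidable (D ∨ -t < 0)} (ht : t ≠ 0) (hor : A ∨ B) :
    (if A ∧ B then (1 : ℝ) else 0) - (if C ∧ 0 < t ∨ D ∧ t < 0 then 1 else 0)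
      = (if A then 1 else 0) - (if C ∨ t < 0 then 1 else 0)
        + ((if B then 1 else 0) - (if D ∨ -t < 0 then 1 else 0)) := by
  rcases lt_or_gt_of_ne ht with h | h <;> by_cases hA : A <;> by_cases hB : B <;>
    by_cases hC : C <;> by_cases hD : D <;> simp_all [h.not_gt]

open Classical in
/-- The indicator function of a polyhedron in `ℝ`, corrected at infinity, is a sum of signed
intervals ending at its vertices. -/
theorem sum_signedInterval
    (huniq : ∀ i ∈ J, ∀ j ∈ J, 0 < β i → 0 < β j → Feasible J β γ (γ i / β i) →
      Feasible J β γ (γ j / β j) → i = j)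
    (huniq' : ∀ i ∈ J, ∀ j ∈ J, β i < 0 → β j < 0 → Feasible J β γ (γ i / β i) →
      Feasible J β γ (γ j / β j) → i = j)
    {t : ℝ} (ht : t ≠ 0) :
    (if Feasible J β γ t then (1 : ℝ) else 0)
        - (if FeasibleAtTop J β γ ∧ 0 < t ∨ FeasibleAtTop J (fun j => -β j) γ ∧ t < 0
            then 1 else 0)
      = ∑ u ∈ J with 0 < β u ∧ Feasible J β γ (γ u / β u), signedInterval (γ u / β u) t
        + ∑ u ∈ J with β u < 0 ∧ Feasible J β γ (γ u / β u),
            signedInterval (-(γ u / β u)) (-t) := by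
  by_cases hne : ∃ s, Feasible J β γ s
  · have hne' : ∃ s, Feasible J (fun j => -β j) γ s := by
      obtain ⟨s, hs⟩ := hne
      exact ⟨-s, (feasible_neg_iff s).mpr hs⟩
    have hdiv : ∀ u, γ u / -β u = -(γ u / β u) := fun u => div_neg _
    have h1 := sum_signedInterval_upper huniq hne ht
    have h2 := sum_signedInterval_upper (J := J) (β := fun j => -β j) (γ := γ) (t := -t)
      (fun i hi j hj hbi hbj => by
        rw [hdiv, hdiv, feasible_neg_iff, feasible_neg_iff]
        exact huniq' i hi j hj (by linarith) (by linarith)) hne' (neg_ne_zero.mpr ht)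
    simp only [hdiv, feasible_neg_iff, Left.neg_pos_iff] at h2
    rw [h1, h2]
    obtain ⟨s, hs⟩ := hne
    have hA : FeasibleAtTop J β γ ↔ ∀ j ∈ J, β j ≤ 0 :=
      ⟨fun h j hj => (h j hj).1, fun h j hj => ⟨h j hj, fun hb => by
        have := hs j hj; rwa [hb, zero_mul] at this⟩⟩
    have hB : FeasibleAtTop J (fun j => -β j) γ ↔ ∀ j ∈ J, -β j ≤ 0 :=
      ⟨fun h j hj => (h j hj).1, fun h j hj => ⟨h j hj, fun hb => by
        have := hs j hj; rwa [neg_eq_zero.mp hb, zero_mul] at this⟩⟩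
    have hF : Feasible J β γ t ↔
        (∀ j ∈ J, 0 < β j → β j * t ≤ γ j) ∧ (∀ j ∈ J, β j < 0 → -β j * -t ≤ γ j) := by
      refine ⟨fun h => ⟨fun j hj _ => h j hj, fun j hj _ => by simpa using h j hj⟩, fun h j hj => ?_⟩
      rcases lt_trichotomy (β j) 0 with hb | hb | hb
      · simpa using h.2 j hj hb
      · have := hs j hj
        rw [hb, zero_mul] at this ⊢
        exact this
      · exact h.1 j hj hb
    -- Comparison of `t` with a feasible `s` settles either all upper or all lower bounds.
    have hor : (∀ j ∈ J, 0 < β j → β j * t ≤ γ j) ∨ (∀ j ∈ J, β j < 0 → -β j * -t ≤ γ j) := by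
      rcases le_total t s with h | h
      · exact Or.inl fun j hj hb => (mul_le_mul_of_nonneg_left h hb.le).trans (hs j hj)
      · exact Or.inr fun j hj hb => by
          rw [neg_mul_neg]
          exact (mul_le_mul_of_nonpos_left h hb.le).trans (hs j hj)
    rw [hA, hB, hF]
    exact ite_identity ht hor
  -- For an empty polyhedron every term vanishes, since feasibility at infinity would produce a
  -- feasible point.
  · have h0 : ∀ t, ¬ Feasible J β γ t := fun t h => hne ⟨t, h⟩
    have hA : ¬ FeasibleAtTop J β γ := fun h => hne h.exists_feasible
    have hB : ¬ FeasibleAtTop J (fun j => -β j) γ := fun h => by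
      obtain ⟨s, hs⟩ := h.exists_feasible
      exact h0 (-s) ((feasible_neg_iff (-s)).mp (by simpa using hs))
    simp [h0, hA, hB]

end Halflines

/-! ### Supporting lines, projection to the hull and visibility. -/

theorem le_of_mem_hull {S : Finset Plane} {a b k : ℝ} (h : ∀ p ∈ S, a * p 0 + b * p 1 ≤ k)
    {x : Plane} (hx : x ∈ hull S) : a * x 0 + b * x 1 ≤ k := by
  have hconv : Convex ℝ {y : Plane | a * y 0 + b * y 1 ≤ k} := by
    intro y hy z hz s t hs ht hst
    simp only [mem_ofPred_eq, PiLp.add_apply, PiLp.smul_apply, smul_eq_mul] at hy hz ⊢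
    calc _ = s * (a * y 0 + b * y 1) + t * (a * z 0 + b * z 1) := by ring
      _ ≤ s * k + t * k := by gcongr
      _ = k := by rw [← add_mul, hst, one_mul]
  exact convexHull_min (fun p hp => h p hp) hconv hx

theorem dp_nonpos_of_mem_hull {S : Finset Plane} {v x : Plane} (h : ∀ p ∈ S, dp v p x ≤ 0)
    {y : Plane} (hy : y ∈ hull S) : dp v y x ≤ 0 := by
  have := le_of_mem_hull (a := x 0 - v 0) (b := x 1 - v 1)
    (k := (x 0 - v 0) * v 0 + (x 1 - v 1) * v 1)
    (fun p hp => by have := h p hp; unfold dp at this; linarith) hy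
  unfold dp; linarith

theorem cp_nonpos_of_mem_hull {S : Finset Plane} {v w : Plane} {k : ℝ}
    (h : ∀ p ∈ S, cp v w p * k ≤ 0) {y : Plane} (hy : y ∈ hull S) : cp v w y * k ≤ 0 := by
  have := le_of_mem_hull (a := -(w 1 - v 1) * k) (b := (w 0 - v 0) * k)
    (k := (-(w 1 - v 1) * v 0 + (w 0 - v 0) * v 1) * k)
    (fun p hp => by have := h p hp; unfold cp at this; linarith) hy
  unfold cp; linarith

theorem mem_hull {S : Finset Plane} {p : Plane} (h : p ∈ S) : p ∈ hull S :=
  subset_convexHull ℝ _ h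

/-- A small step from `q` in the direction `(a, b)` leaves the supporting half-plane, so `q` is not
interior. -/
theorem mem_frontier_of_support {S : Finset Plane} {a b : ℝ} (hab : a ≠ 0 ∨ b ≠ 0) {q : Plane}
    (hq : q ∈ hull S) (h : ∀ p ∈ S, a * p 0 + b * p 1 ≤ a * q 0 + b * q 1) :
    q ∈ frontier (hull S) := by
  refine ⟨subset_closure hq, fun hint => ?_⟩
  have hcont : Continuous fun t : ℝ => q + t • (!₂[a, b] : Plane) := by fun_prop
  have h0 : (fun t : ℝ => q + t • (!₂[a, b] : Plane)) 0 ∈ interior (hull S) := by simpa using hint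
  have hev := hcont.continuousAt.eventually (isOpen_interior.mem_nhds h0)
  obtain ⟨ε, hε, hball⟩ := Metric.eventually_nhds_iff.mp hev
  have hm := interior_subset (hball (y := ε / 2) (by
    rw [Real.dist_eq, sub_zero, abs_of_pos (by linarith)]; linarith))
  have := le_of_mem_hull h hm
  simp only [PiLp.add_apply, PiLp.smul_apply, smul_eq_mul, Matrix.cons_val_zero,
    Matrix.cons_val_one] at this
  have hpos : 0 < a * a + b * b := by
    rcases hab with h | h
    · have := mul_self_pos.mpr h
      nlinarith [mul_self_nonneg b]
    · have := mul_self_pos.mpr h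
      nlinarith [mul_self_nonneg a]
  nlinarith

theorem exists_projection {S : Finset Plane} (hne : S.Nonempty) (x : Plane) :
    ∃ q ∈ hull S, ∀ p ∈ S, dp q x p ≤ 0 := by
  have hcl : IsClosed (hull S) := (S.finite_toSet.isCompact_convexHull (𝕜 := ℝ)).isClosed
  have hn : (hull S).Nonempty := ⟨_, mem_hull hne.choose_spec⟩
  have hconv : Convex ℝ (hull S) := convex_convexHull ℝ _
  obtain ⟨q, hq, hmin⟩ := exists_norm_eq_iInf_of_complete_convex hn hcl.isComplete hconv x
  refine ⟨q, hq, fun p hp => ?_⟩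
  have := (norm_eq_iInf_iff_real_inner_le_zero hconv hq).mp hmin p (mem_hull hp)
  rw [PiLp.inner_apply] at this
  simp only [Fin.sum_univ_two, PiLp.sub_apply, RCLike.inner_apply, conj_trivial] at this
  unfold dp; linarith

/-- Along the boundary of the hull, `v` and `w` are consecutive points of `S` on a supporting line
which strictly separates `x` from the hull. -/
def FacesEdge (S : Finset Plane) (v w x : Plane) : Prop :=
  cp v w x ≠ 0 ∧ ∀ p ∈ S, cp v w p * cp v w x ≤ 0 ∧ (cp v w p = 0 → 0 ≤ dp p v w)

theorem dp_comm (o p q : Plane) : dp o p q = dp o q p := by unfold dp; ring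

theorem FacesEdge.symm {S : Finset Plane} {v w x : Plane} (h : FacesEdge S v w x) :
    FacesEdge S w v x := by
  have e : ∀ p, cp w v p = -cp v w p := fun p => by unfold cp; ring
  simp only [FacesEdge, e, neg_mul_neg, neg_eq_zero, ne_eq]
  exact ⟨h.1, fun p hp => ⟨(h.2 p hp).1, fun h0 => by
    rw [dp_comm]; exact (h.2 p hp).2 h0⟩⟩

theorem FacesEdge.segment_subset_frontier {S : Finset Plane} {v w x : Plane}
    (h : FacesEdge S v w x) (hv : v ∈ S) (hw : w ∈ S) : segment ℝ v w ⊆ frontier (hull S) := by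
  rintro q ⟨a, b, ha, hb, hab, rfl⟩
  have hwv : w 1 - v 1 ≠ 0 ∨ w 0 - v 0 ≠ 0 := by
    by_contra! h0
    apply h.1
    unfold cp
    rw [h0.1, h0.2]; ring
  refine mem_frontier_of_support (a := -(w 1 - v 1) * cp v w x) (b := (w 0 - v 0) * cp v w x)
    ?_ (convex_convexHull ℝ _ (mem_hull hv) (mem_hull hw) ha hb hab) fun p hp => ?_
  · rcases hwv with h0 | h0
    · exact Or.inl (mul_ne_zero (neg_ne_zero.mpr h0) h.1)
    · exact Or.inr (mul_ne_zero h0 h.1)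
  · have h1 := (h.2 p hp).1
    have h2 : cp v w p * cp v w x = (-(w 1 - v 1) * cp v w x) * p 0 + ((w 0 - v 0) * cp v w x) * p 1
        - ((-(w 1 - v 1) * cp v w x) * v 0 + ((w 0 - v 0) * cp v w x) * v 1) := by
      conv_lhs => unfold cp
      unfold cp; ring
    simp only [PiLp.add_apply, PiLp.smul_apply, smul_eq_mul]
    have ha' : a = 1 - b := by linarith
    subst ha'
    nlinarith

theorem notMem_hull_of_facesEdge {S : Finset Plane} {v w x : Plane} (h : FacesEdge S v w x) :
    x ∉ hull S := fun hx => by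
  have := cp_nonpos_of_mem_hull (fun p hp => (h.2 p hp).1) hx
  exact h.1 (by nlinarith [mul_self_nonneg (cp v w x)])

theorem eq_of_mem_hull_of_dp_nonpos {S : Finset Plane} {v x : Plane}
    (h : ∀ p ∈ S, dp v p x ≤ 0) (hx : x ∈ hull S) : x = v :=
  eq_of_dp_self_le (dp_nonpos_of_mem_hull h hx)

/-- The point `x` lies in the normal cone at `v`: the hull is contained in the half-plane through
`v` facing away from `x`, so `v` is visible and even nearest among all hull points. -/
theorem isNearest_visible_of_dp_nonpos {S : Finset Plane} {v x : Plane} (hv : v ∈ S)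
    (hxv : x ≠ v) (h : ∀ p ∈ S, dp v p x ≤ 0) : IsNearest (visibleVertices S x) x v := by
  refine ⟨⟨⟨hv, ?_⟩, ?_⟩, fun q hq => ?_⟩
  · refine mem_frontier_of_support (a := x 0 - v 0) (b := x 1 - v 1) ?_ (mem_hull hv)
      fun p hp => by have := h p hp; unfold dp at this; linarith
    by_contra! h0
    refine hxv (eq_of_dp_self_le ?_)
    unfold dp; rw [h0.1, h0.2]; simp
  · ext y
    simp only [mem_inter_iff, mem_singleton_iff]
    constructor
    · rintro ⟨⟨a, b, ha, hb, hab, rfl⟩, hy⟩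
      have h1 := dp_nonpos_of_mem_hull h hy
      have h2 : dp v (a • x + b • v) x = a * dp v x x := by
        simp only [dp, PiLp.add_apply, PiLp.smul_apply, smul_eq_mul]
        have : b = 1 - a := by linarith
        subst this; ring
      rw [h2] at h1
      have h3 := dp_self_pos hxv
      have : a = 0 := by nlinarith
      subst this
      have : b = 1 := by linarith
      subst this
      simp
    · rintro rfl
      exact ⟨right_mem_segment ℝ x y, mem_hull hv⟩
  · rw [dist_le_dist_iff]
    have h1 := h q hq.1.1
    have h2 := dp_self_nonneg v q
    have h3 : dp q x x = dp v x x - 2 * dp v q x + dp v q q := by unfold dp; ring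
    linarith

/-- In coordinates along and across the line `vw`, a visible `u` off this line is seen through a
point of the line outside `[v, w]`. Hence `u` is at least as far from `x` as `v` in both
coordinates. A `u` on the line lies outside the open segment. -/
theorem isNearest_visible_of_facesEdge {S : Finset Plane} {v w x : Plane} (hv : v ∈ S) (hw : w ∈ S)
    (h : FacesEdge S v w x) (h0 : 0 < dp v w x) (h1 : 2 * dp v w x ≤ dp v w w) :
    IsNearest (visibleVertices S x) x v := by
  have hc : 0 < dp v w w := by linarith
  refine ⟨⟨⟨hv, h.segment_subset_frontier hv hw (left_mem_segment ℝ v w)⟩, ?_⟩, fun u hu => ?_⟩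
  · ext y
    simp only [mem_inter_iff, mem_singleton_iff]
    constructor
    · rintro ⟨⟨a, b, ha, hb, hab, rfl⟩, hy⟩
      have h1 := cp_nonpos_of_mem_hull (fun p hp => (h.2 p hp).1) hy
      have h2 : cp v w (a • x + b • v) = a * cp v w x := by
        simp only [cp, PiLp.add_apply, PiLp.smul_apply, smul_eq_mul]
        have : b = 1 - a := by linarith
        subst this; ring
      rw [h2] at h1
      have h3 := mul_self_pos.mpr h.1
      have : a = 0 := by nlinarith
      subst this
      have : b = 1 := by linarith
      subst this
      simp
    · rintro rfl
      exact ⟨right_mem_segment ℝ x y, mem_hull hv⟩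
  · rw [dist_le_dist_iff]
    have hd : dp v w w * dp u x x
        = (dp v w u - dp v w x) ^ 2 + (cp v w u - cp v w x) ^ 2 := by unfold dp cp; ring
    have hd0 := dp_sq_add_cp_sq v w x
    suffices dp v w x ^ 2 + cp v w x ^ 2
        ≤ (dp v w u - dp v w x) ^ 2 + (cp v w u - cp v w x) ^ 2 by
      rw [hd0, ← hd] at this
      exact le_of_mul_le_mul_left this hc
    have hu2 := h.2 u hu.1.1
    by_cases hU : cp v w u = 0
    · have h3 := hu2.2 hU
      have h4 : dp v w w * dp u v w = dp v w u ^ 2 - dp v w w * dp v w u + cp v w u ^ 2 := by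
        unfold dp cp; ring
      have h5 : 0 ≤ dp v w w * dp u v w := mul_nonneg hc.le h3
      rw [h4, hU] at h5
      rw [hU]
      rcases le_or_gt (dp v w u) 0 with hA | hA
      · nlinarith
      · have : dp v w w ≤ dp v w u := by nlinarith
        nlinarith
    · have hneg : cp v w u * cp v w x < 0 :=
        lt_of_le_of_ne hu2.1 (mul_ne_zero hU h.1)
      have hX2 := mul_self_pos.mpr h.1
      -- The segment from `x` to `u` crosses the line `vw` at parameter `s`.
      set s := cp v w x / (cp v w x - cp v w u) with hs
      have hden : cp v w x - cp v w u ≠ 0 := fun h0 => by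
        have : cp v w x = cp v w u := by linarith
        rw [this] at hneg; nlinarith [mul_self_nonneg (cp v w u)]
      have hs0 : 0 < s := by
        have : s = (cp v w x * cp v w x) / ((cp v w x - cp v w u) * cp v w x) := by
          rw [hs]; field_simp [h.1]
        rw [this]
        exact div_pos hX2 (by linarith)
      have hs1 : s < 1 := by
        have : 1 - s = (-(cp v w u * cp v w x)) / ((cp v w x - cp v w u) * cp v w x) := by
          rw [hs]; field_simp [h.1]; ring
        have : 0 < 1 - s := by rw [this]; exact div_pos (by linarith) (by linarith)
        linarith
      set y : Plane := (1 - s) • x + s • u with hy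
      have hys : y ∈ segment ℝ x u := ⟨1 - s, s, by linarith, hs0.le, by ring, rfl⟩
      have hY : dp v w y = dp v w x + s * (dp v w u - dp v w x) := by
        simp only [hy, dp, PiLp.add_apply, PiLp.smul_apply, smul_eq_mul]; ring
      have hYc : cp v w y = 0 := by
        have : cp v w y = cp v w x - s * (cp v w x - cp v w u) := by
          simp only [hy, cp, PiLp.add_apply, PiLp.smul_apply, smul_eq_mul]; ring
        rw [this, hs]; field_simp; ring
      -- A crossing inside `[v, w]` would be a hull point other than `u` on the segment, against
      -- visibility.
      have hout : dp v w y < 0 ∨ dp v w w < dp v w y := by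
        by_contra! hin
        have hyvw : y ∈ segment ℝ v w := by
          refine ⟨1 - dp v w y / dp v w w, dp v w y / dp v w w, ?_, div_nonneg hin.1 hc.le,
            by ring, ?_⟩
          · have := (div_le_one hc).mpr hin.2
            linarith
          · refine eq_of_dp_self_le (o := y) (le_of_eq ?_)
            have hk : ∀ k : ℝ, dp v w w * dp y ((1 - k) • v + k • w) ((1 - k) • v + k • w)
                = (k * dp v w w - dp v w y) ^ 2 + cp v w y ^ 2 := fun k => by
              simp only [dp, cp, PiLp.add_apply, PiLp.smul_apply, smul_eq_mul]; ring
            have := hk (dp v w y / dp v w w)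
            rw [div_mul_cancel₀ _ hc.ne', hYc] at this
            have h9 : dp v w w * dp y ((1 - dp v w y / dp v w w) • v + (dp v w y / dp v w w) • w)
              ((1 - dp v w y / dp v w w) • v + (dp v w y / dp v w w) • w) = 0 := by
              rw [this]; ring
            exact (mul_eq_zero.mp h9).resolve_left hc.ne'
        have hyH : y ∈ hull S :=
          (convex_convexHull ℝ _).segment_subset (mem_hull hv) (mem_hull hw) hyvw
        have hyu : y ∈ ({u} : Set Plane) := hu.2 ▸ ⟨hys, hyH⟩
        rw [mem_singleton_iff] at hyu
        exact hU (hyu ▸ hYc)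
      have hXU : cp v w x ^ 2 ≤ (cp v w u - cp v w x) ^ 2 := by nlinarith [sq_nonneg (cp v w u)]
      have hAs : (dp v w y - dp v w x) ^ 2 ≤ (dp v w u - dp v w x) ^ 2 := by
        have : dp v w y - dp v w x = s * (dp v w u - dp v w x) := by rw [hY]; ring
        rw [this, mul_pow]
        have hs2 : s ^ 2 ≤ 1 := by nlinarith
        nlinarith [sq_nonneg (dp v w u - dp v w x)]
      have hD : dp v w x ^ 2 ≤ (dp v w y - dp v w x) ^ 2 := by
        rcases hout with h | h
        · nlinarith
        · nlinarith
      linarith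

/-- A point outside the hull either projects to a point of `S` or to an edge of the hull. -/
theorem exists_face {S : Finset Plane} (hne : S.Nonempty) {x : Plane} (hx : x ∉ hull S) :
    ∃ v ∈ S, (∀ p ∈ S, dp v p x ≤ 0) ∨
      ∃ w ∈ S, FacesEdge S v w x ∧ 0 < dp v w x ∧ 2 * dp v w x ≤ dp v w w := by
  obtain ⟨q, hq, hproj⟩ := exists_projection hne x
  by_cases hqS : q ∈ S
  · exact ⟨q, hqS, Or.inl fun p hp => by rw [dp_comm]; exact hproj p hp⟩
  have hxq : x ≠ q := fun h => hx (h ▸ hq)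
  have hN := dp_self_pos hxq
  have hpq : ∀ p ∈ S, dp q x p = 0 → cp q x p ≠ 0 := fun p hp h1 h2 => by
    have := dp_sq_add_cp_sq q x p
    rw [h1, h2] at this
    have h0 : dp q p p = 0 := by
      have : dp q x x * dp q p p = 0 := by rw [← this]; ring
      exact (mul_eq_zero.mp this).resolve_left hN.ne'
    exact hqS (eq_of_dp_self_le h0.le ▸ hp)
  -- The projection `q` is a convex combination of `S`. The terms `dp q x p` are nonpositive with
  -- weighted sum zero, so all weight sits on the line through `q` orthogonal to `x - q`. As `q ∉
  -- S`, weight must occur on both sides of `q`, for otherwise the weighted sum of `cp q x p` could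
  -- not vanish.
  have hside : ∀ ε : ℝ, ε = 1 ∨ ε = -1 → ∃ p ∈ S, dp q x p = 0 ∧ 0 < ε * cp q x p := by
    intro ε hε
    have hε0 : ε ≠ 0 := by rcases hε with h | h <;> rw [h] <;> norm_num
    by_contra! hcon
    obtain ⟨wt, hwt0, hwt1, hwtq⟩ := Finset.mem_convexHull'.mp hq
    have hc : ∀ i : Fin 2, ∑ p ∈ S, wt p * (p i - q i) = 0 := fun i => by
      have := congrArg (fun y : Plane => y i) hwtq
      simp only [WithLp.ofLp_sum, Finset.sum_apply, PiLp.smul_apply, smul_eq_mul] at this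
      simp only [mul_sub, Finset.sum_sub_distrib, ← Finset.sum_mul, hwt1, one_mul]
      linarith
    have hsum : ∀ a b : ℝ, ∑ p ∈ S, wt p * (a * (p 0 - q 0) + b * (p 1 - q 1)) = 0 := fun a b => by
      have : ∀ p : Plane, wt p * (a * (p 0 - q 0) + b * (p 1 - q 1))
          = a * (wt p * (p 0 - q 0)) + b * (wt p * (p 1 - q 1)) := fun p => by ring
      simp only [this, Finset.sum_add_distrib, ← Finset.mul_sum, hc]
      ring
    have hdp : ∑ p ∈ S, wt p * dp q x p = 0 := hsum (x 0 - q 0) (x 1 - q 1)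
    have hcp : ∑ p ∈ S, wt p * (ε * cp q x p) = 0 := by
      rw [← hsum (-(x 1 - q 1) * ε) ((x 0 - q 0) * ε)]
      refine Finset.sum_congr rfl fun p _ => ?_
      unfold cp; ring
    have h1 := (Finset.sum_eq_zero_iff_of_nonpos fun p hp =>
      mul_nonpos_of_nonneg_of_nonpos (hwt0 p hp) (hproj p hp)).mp hdp
    have h2 := (Finset.sum_eq_zero_iff_of_nonpos fun p hp => by
      rcases (mul_eq_zero.mp (h1 p hp)) with h | h
      · rw [h, zero_mul]
      · exact mul_nonpos_of_nonneg_of_nonpos (hwt0 p hp) (hcon p hp h)).mp hcp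
    have h3 : ∀ p ∈ S, wt p = 0 := fun p hp => by
      by_contra h0
      have ha := (mul_eq_zero.mp (h1 p hp)).resolve_left h0
      have hb := (mul_eq_zero.mp (h2 p hp)).resolve_left h0
      exact hpq p hp ha ((mul_eq_zero.mp hb).resolve_left hε0)
    rw [Finset.sum_eq_zero h3] at hwt1
    exact zero_ne_one hwt1
  classical
  -- The points of `S` closest to `q` on either side are consecutive on the supporting line.
  obtain ⟨v, hv, hvmin⟩ := Finset.exists_min_image
    (S.filter fun p => dp q x p = 0 ∧ 0 < cp q x p) (fun p => cp q x p) (by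
      obtain ⟨p, hp, h1, h2⟩ := hside 1 (Or.inl rfl)
      exact ⟨p, by simp only [Finset.mem_filter]; exact ⟨hp, h1, by linarith⟩⟩)
  obtain ⟨w, hw, hwmax⟩ := Finset.exists_max_image
    (S.filter fun p => dp q x p = 0 ∧ cp q x p < 0) (fun p => cp q x p) (by
      obtain ⟨p, hp, h1, h2⟩ := hside (-1) (Or.inr rfl)
      exact ⟨p, by simp only [Finset.mem_filter]; exact ⟨hp, h1, by linarith⟩⟩)
  rw [Finset.mem_filter] at hv hw
  have hdpN : ∀ o p r : Plane, dp q x x * dp o p r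
      = (dp q x p - dp q x o) * (dp q x r - dp q x o)
        + (cp q x p - cp q x o) * (cp q x r - cp q x o) := fun o p r => by unfold dp cp; ring
  have hcpN : ∀ o p r : Plane, dp q x x * cp o p r
      = (dp q x p - dp q x o) * (cp q x r - cp q x o)
        - (cp q x p - cp q x o) * (dp q x r - dp q x o) := fun o p r => by unfold dp cp; ring
  have hxx : cp q x x = 0 := by unfold cp; ring
  have hdx : dp v w x * dp q x x = (cp q x v - cp q x w) * cp q x v := by
    rw [mul_comm, hdpN, hv.2.1, hw.2.1, hxx]; ring
  have hdw : dp v w w * dp q x x = (cp q x v - cp q x w) ^ 2 := by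
    rw [mul_comm, hdpN, hv.2.1, hw.2.1]; ring
  have hcx : cp v w x = cp q x v - cp q x w := by
    have := hcpN v w x
    rw [hv.2.1, hw.2.1, hxx] at this
    refine mul_left_cancel₀ hN.ne' ?_
    rw [this]; ring
  have hpos : 0 < cp q x v - cp q x w := by linarith [hv.2.2, hw.2.2]
  have hFE : FacesEdge S v w x := by
    refine ⟨hcx ▸ hpos.ne', fun p hp => ?_⟩
    have hcpp : dp q x x * cp v w p = (cp q x v - cp q x w) * dp q x p := by
      rw [hcpN, hv.2.1, hw.2.1]; ring
    constructor
    · rw [hcx]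
      refine mul_nonpos_of_nonpos_of_nonneg ?_ hpos.le
      have : dp q x x * cp v w p ≤ 0 := by
        rw [hcpp]; exact mul_nonpos_of_nonneg_of_nonpos hpos.le (hproj p hp)
      by_contra! h0
      exact absurd (mul_pos hN h0) this.not_gt
    · intro h0
      rw [h0, mul_zero] at hcpp
      have hp0 : dp q x p = 0 := (mul_eq_zero.mp hcpp.symm).resolve_left hpos.ne'
      have hd : dp q x x * dp p v w = (cp q x v - cp q x p) * (cp q x w - cp q x p) := by
        rw [hdpN, hv.2.1, hw.2.1, hp0]; ring
      have : 0 ≤ dp q x x * dp p v w := by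
        rw [hd]
        rcases lt_or_gt_of_ne (hpq p hp hp0) with hl | hl
        · have := hwmax p (by simp [hp, hp0, hl])
          exact mul_nonneg (by linarith [hv.2.2]) (by linarith)
        · have := hvmin p (by simp [hp, hp0, hl])
          exact mul_nonneg_of_nonpos_of_nonpos (by linarith) (by linarith [hw.2.2])
      exact nonneg_of_mul_nonneg_right this hN
  have hd0 : 0 < dp v w x := by
    have : 0 < dp v w x * dp q x x := by rw [hdx]; exact mul_pos hpos hv.2.2
    exact pos_of_mul_pos_left this hN.le
  have hd1 : dp v w x < dp v w w := by
    refine lt_of_mul_lt_mul_right (a := dp q x x) ?_ hN.le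
    rw [hdx, hdw, sq]
    exact mul_lt_mul_of_pos_left (by linarith [hw.2.2]) hpos
  rcases le_or_gt (2 * dp v w x) (dp v w w) with hle | hgt
  · exact ⟨v, hv.1, Or.inr ⟨w, hw.1, hFE, hd0, hle⟩⟩
  · have e1 : dp w v x = dp v w w - dp v w x := by unfold dp; ring
    have e2 : dp w v v = dp v w w := by unfold dp; ring
    exact ⟨w, hw.1, Or.inr ⟨v, hv.1, hFE.symm, by rw [e1]; linarith, by rw [e1, e2]; linarith⟩⟩

/-! ### Pointwise decomposition of the integrand at generic points. -/

/-- The nearest point of the hull to `x` lies on the edge `[v, w]`, closer to `v` than to `w`. -/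
def ProjectsNear (S : Finset Plane) (v w x : Plane) : Prop :=
  FacesEdge S v w x ∧ 0 < dp v w x ∧ 2 * dp v w x < dp v w w

/-- The ray from `v` through `x` passes through `x` before it leaves the Voronoi cell of `v` through
the cell of `w`. -/
def ExitsThrough (S : Finset Plane) (v w x : Plane) : Prop :=
  0 < dp v w x ∧ 2 * dp v w x < dp v w w ∧
    ∀ p ∈ S, dp v p x * dp v w w ≤ dp v w x * dp v p p

/-- The projection `q` is the foot of the perpendicular from `x` to `vw`. Expressing `v` and `w`
through `q` and `x` makes the pair comparable with any other pair that `x` projects to. -/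
theorem ProjectsNear.projection {S : Finset Plane} {v w x q : Plane} (h : ProjectsNear S v w x)
    (hv : v ∈ S) (hw : w ∈ S) (hq : q ∈ hull S) (hproj : ∀ p ∈ S, dp q x p ≤ 0) :
    dp q x v = 0 ∧ dp q x w = 0 ∧ cp q x v * cp q x w < 0 ∧ cp q x v ^ 2 < cp q x w ^ 2 ∧
      ∀ p ∈ S, dp q x p = 0 → 0 ≤ (cp q x v - cp q x p) * (cp q x w - cp q x p) := by
  obtain ⟨hF, h0, h1⟩ := h
  have hc : 0 < dp v w w := by linarith
  have hU := cp_nonpos_of_mem_hull (fun p hp => (hF.2 p hp).1) hq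
  have hdpc : ∀ p, dp v w w * dp q x p = (dp v w x - dp v w q) * (dp v w p - dp v w q)
      + (cp v w x - cp v w q) * (cp v w p - cp v w q) := fun p => by unfold dp cp; ring
  have hcpc : ∀ p, dp v w w * cp q x p = (dp v w x - dp v w q) * (cp v w p - cp v w q)
      - (cp v w x - cp v w q) * (dp v w p - dp v w q) := fun p => by unfold dp cp; ring
  have hvv : dp v w v = 0 := by unfold dp; ring
  have hvc : cp v w v = 0 := by unfold cp; ring
  have hwc : cp v w w = 0 := by unfold cp; ring
  have i1 : dp v w w * dp q x v ≤ 0 := mul_nonpos_of_nonneg_of_nonpos hc.le (hproj v hv)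
  have i2 : dp v w w * dp q x w ≤ 0 := mul_nonpos_of_nonneg_of_nonpos hc.le (hproj w hw)
  rw [hdpc, hvv, hvc] at i1
  rw [hdpc, hwc] at i2
  have key : dp v w w * ((dp v w x - dp v w q) ^ 2 + cp v w q ^ 2 - cp v w q * cp v w x) ≤ 0 := by
    -- These weights on `v` and `w` produce the foot of the perpendicular as convex combination.
    have j1 := mul_nonpos_of_nonneg_of_nonpos (a := dp v w w - dp v w x) (by linarith) i1
    have j2 := mul_nonpos_of_nonneg_of_nonpos h0.le i2
    nlinarith
  have key' : (dp v w x - dp v w q) ^ 2 + cp v w q ^ 2 - cp v w q * cp v w x ≤ 0 := by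
    by_contra! hcon
    exact absurd (mul_pos hc hcon) key.not_gt
  have hA : dp v w q = dp v w x := by
    have : (dp v w x - dp v w q) ^ 2 = 0 :=
      le_antisymm (by linarith [sq_nonneg (cp v w q)]) (sq_nonneg _)
    linarith [pow_eq_zero_iff (two_ne_zero) |>.mp this]
  have hQ : cp v w q = 0 := by
    have : cp v w q ^ 2 = 0 :=
      le_antisymm (by linarith [sq_nonneg (dp v w x - dp v w q)]) (sq_nonneg _)
    exact pow_eq_zero_iff (two_ne_zero) |>.mp this
  simp only [hA, hQ, sub_self, zero_mul, zero_add, sub_zero, zero_sub] at hdpc hcpc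
  have hlv : dp v w w * cp q x v = cp v w x * dp v w x := by rw [hcpc, hvv]; ring
  have hlw : dp v w w * cp q x w = - (cp v w x * (dp v w w - dp v w x)) := by rw [hcpc]
  have hX := mul_self_pos.mpr hF.1
  have hc2 : 0 < dp v w w ^ 2 := by positivity
  refine ⟨?_, ?_, ?_, ?_, fun p hp hp0 => ?_⟩
  · exact (mul_eq_zero.mp ((hdpc v).trans (by rw [hvc, mul_zero]))).resolve_left hc.ne'
  · exact (mul_eq_zero.mp ((hdpc w).trans (by rw [hwc, mul_zero]))).resolve_left hc.ne'
  · have : dp v w w ^ 2 * (cp q x v * cp q x w)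
        = -((cp v w x * cp v w x) * (dp v w x * (dp v w w - dp v w x))) := by
      calc _ = (dp v w w * cp q x v) * (dp v w w * cp q x w) := by ring
        _ = _ := by rw [hlv, hlw]; ring
    have hn : dp v w w ^ 2 * (cp q x v * cp q x w) < 0 := by
      rw [this, neg_lt_zero]
      exact mul_pos hX (mul_pos h0 (by linarith))
    by_contra! hcon
    exact absurd (mul_nonneg hc2.le hcon) hn.not_ge
  · refine lt_of_mul_lt_mul_left (a := dp v w w ^ 2) ?_ hc2.le
    rw [← mul_pow, ← mul_pow, hlv, hlw, neg_sq, mul_pow, mul_pow]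
    exact mul_lt_mul_of_pos_left (pow_lt_pow_left₀ (by linarith) h0.le two_ne_zero)
      (by rw [sq]; exact hX)
  · have hP : cp v w p = 0 := by
      have := hdpc p
      rw [hp0, mul_zero] at this
      exact (mul_eq_zero.mp this.symm).resolve_left hF.1
    have h2 := (hF.2 p hp).2 hP
    have hxq : x ≠ q := fun h => hF.1 (h ▸ hQ)
    have hid : dp q x x * dp p v w = (dp q x v - dp q x p) * (dp q x w - dp q x p)
        + (cp q x v - cp q x p) * (cp q x w - cp q x p) := by unfold dp cp; ring
    have z1 : dp q x v = 0 :=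
      (mul_eq_zero.mp ((hdpc v).trans (by rw [hvc, mul_zero]))).resolve_left hc.ne'
    rw [z1, hp0] at hid
    have := mul_nonneg (dp_self_nonneg q x) h2
    rw [hid] at this
    linarith

/-- Two pairs enclosing `0`, neither having a member of the other strictly inside, agree as sets;
the comparison of squares fixes the order. -/
theorem eq_of_interlaced {a b a' b' : ℝ} (h1 : a * b < 0) (h2 : a ^ 2 < b ^ 2) (h1' : a' * b' < 0)
    (h2' : a' ^ 2 < b' ^ 2) (h3 : 0 ≤ (a - a') * (b - a')) (h4 : 0 ≤ (a - b') * (b - b'))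
    (h5 : 0 ≤ (a' - a) * (b' - a)) (h6 : 0 ≤ (a' - b) * (b' - b)) : a = a' ∧ b = b' := by
  rcases mul_neg_iff.mp h1 with ⟨ha, hb⟩ | ⟨ha, hb⟩ <;>
    rcases mul_neg_iff.mp h1' with ⟨ha', hb'⟩ | ⟨ha', hb'⟩
  · exact ⟨by nlinarith, by nlinarith⟩
  · have e1 : a = b' := by nlinarith
    have e2 : b = a' := by nlinarith
    subst e1 e2
    exact absurd h2 h2'.not_gt
  · have e1 : a = b' := by nlinarith
    have e2 : b = a' := by nlinarith
    subst e1 e2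
    exact absurd h2 h2'.not_gt
  · exact ⟨by nlinarith, by nlinarith⟩

theorem eq_of_dp_cp_eq {q x p r : Plane} (hxq : x ≠ q) (h1 : dp q x p = dp q x r)
    (h2 : cp q x p = cp q x r) : p = r := by
  have hid : dp q x x * dp r p p
      = (dp q x p - dp q x r) ^ 2 + (cp q x p - cp q x r) ^ 2 := by unfold dp cp; ring
  rw [h1, h2] at hid
  have : dp q x x * dp r p p = 0 := by rw [hid]; ring
  exact eq_of_dp_self_le ((mul_eq_zero.mp this).resolve_left (dp_self_pos hxq).ne').le

/-- The position of `x` is general with respect to the finite set `S`. -/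
structure Generic (S : Finset Plane) (x : Plane) : Prop where
  ne : ∀ v ∈ S, x ≠ v
  bisector : ∀ v ∈ S, ∀ w ∈ S, w ≠ v → 2 * dp v w x ≠ dp v w w
  -- Excludes the rays from `v` that reach the bisectors with `w` and with `p` simultaneously.
  ray : ∀ v ∈ S, ∀ w ∈ S, ∀ p ∈ S, w ≠ v → p ≠ v → p ≠ w →
    dp v p x * dp v w w ≠ dp v w x * dp v p p
  -- Excludes the lines from `v` through circumcenters, which bound the flags.
  line : ∀ v ∈ S, ∀ w ∈ S, w ≠ v → ∀ u ∈ S,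
    cp v w x ≠ 2 * dp v w x * (dp u v w / (2 * cp v w u))
  cp_ne : ∀ v ∈ S, ∀ w ∈ S, w ≠ v → cp v w x ≠ 0

theorem coord_sub_ne {v w : Plane} (h : w ≠ v) : w 0 - v 0 ≠ 0 ∨ w 1 - v 1 ≠ 0 := by
  by_contra! h0
  refine h (eq_of_dp_self_le ?_)
  unfold dp; rw [h0.1, h0.2]; simp

theorem ae_cp_ne {v w : Plane} (h : w ≠ v) (s : ℝ) :
    ∀ᵐ x : Plane, cp v w x ≠ 2 * dp v w x * s := by
  have hc := dp_self_pos h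
  filter_upwards [ae_linear_ne (-(w 1 - v 1) - 2 * s * (w 0 - v 0))
    ((w 0 - v 0) - 2 * s * (w 1 - v 1))
    ((-(w 1 - v 1) - 2 * s * (w 0 - v 0)) * v 0 + ((w 0 - v 0) - 2 * s * (w 1 - v 1)) * v 1) (by
      by_contra! h0
      have : (1 + 4 * s ^ 2) * dp v w w = (-(w 1 - v 1) - 2 * s * (w 0 - v 0)) ^ 2
        + ((w 0 - v 0) - 2 * s * (w 1 - v 1)) ^ 2 := by unfold dp; ring
      rw [h0.1, h0.2] at this
      have h2 : 0 < (1 + 4 * s ^ 2) * dp v w w := by positivity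
      rw [this] at h2; norm_num at h2)] with x hx hx'
  apply hx
  unfold cp dp at hx'
  linarith

theorem ae_generic (S : Finset Plane) : ∀ᵐ x : Plane, Generic S x := by
  have hall : ∀ {P : Plane → Plane → Prop}, (∀ v ∈ S, ∀ᵐ x, P v x) → ∀ᵐ x, ∀ v ∈ S, P v x :=
    fun h => (ae_ball_iff S.countable_toSet).mpr h
  have h1 : ∀ᵐ x : Plane, ∀ v ∈ S, x ≠ v := hall fun v _ => ae_ne v
  have h2 : ∀ᵐ x : Plane, ∀ v ∈ S, ∀ w ∈ S, w ≠ v → 2 * dp v w x ≠ dp v w w := by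
    refine hall fun v _ => hall fun w _ => ?_
    by_cases h : w = v
    · exact Filter.Eventually.of_forall fun x h' => absurd h h'
    filter_upwards [ae_linear_ne (2 * (w 0 - v 0)) (2 * (w 1 - v 1))
      (dp v w w + 2 * (w 0 - v 0) * v 0 + 2 * (w 1 - v 1) * v 1)
      ((coord_sub_ne h).imp (mul_ne_zero two_ne_zero) (mul_ne_zero two_ne_zero))] with x hx _ hx'
    apply hx
    rw [← hx']
    unfold dp; ring
  have h3 : ∀ᵐ x : Plane, ∀ v ∈ S, ∀ w ∈ S, ∀ p ∈ S, w ≠ v → p ≠ v → p ≠ w →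
      dp v p x * dp v w w ≠ dp v w x * dp v p p := by
    refine hall fun v _ => hall fun w _ => hall fun p _ => ?_
    by_cases h : w ≠ v ∧ p ≠ v ∧ p ≠ w
    · have hw := dp_self_pos h.1
      have hp := dp_self_pos h.2.1
      filter_upwards [ae_linear_ne ((p 0 - v 0) * dp v w w - (w 0 - v 0) * dp v p p)
        ((p 1 - v 1) * dp v w w - (w 1 - v 1) * dp v p p)
        (((p 0 - v 0) * dp v w w - (w 0 - v 0) * dp v p p) * v 0
          + ((p 1 - v 1) * dp v w w - (w 1 - v 1) * dp v p p) * v 1) (by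
          by_contra! h0
          have : dp v w w * dp v p p * dp w p p
              = ((p 0 - v 0) * dp v w w - (w 0 - v 0) * dp v p p) ^ 2
                + ((p 1 - v 1) * dp v w w - (w 1 - v 1) * dp v p p) ^ 2 := by unfold dp; ring
          rw [h0.1, h0.2] at this
          have h2 : 0 < dp v w w * dp v p p * dp w p p :=
            mul_pos (mul_pos hw hp) (dp_self_pos h.2.2)
          rw [this] at h2; norm_num at h2)] with x hx _ _ _ hx'
      apply hx
      have e1 : dp v p x = (p 0 - v 0) * (x 0 - v 0) + (p 1 - v 1) * (x 1 - v 1) := rfl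
      have e2 : dp v w x = (w 0 - v 0) * (x 0 - v 0) + (w 1 - v 1) * (x 1 - v 1) := rfl
      rw [e1, e2] at hx'
      linarith
    · exact Filter.Eventually.of_forall fun x a b c => absurd ⟨a, b, c⟩ h
  have h4 : ∀ᵐ x : Plane, ∀ v ∈ S, ∀ w ∈ S, ∀ u ∈ S, w ≠ v →
      cp v w x ≠ 2 * dp v w x * (dp u v w / (2 * cp v w u)) := by
    refine hall fun v _ => hall fun w _ => hall fun u _ => ?_
    by_cases h : w = v
    · exact Filter.Eventually.of_forall fun x h' => absurd h h'
    · filter_upwards [ae_cp_ne h (dp u v w / (2 * cp v w u))] with x hx _ using hx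
  have h5 : ∀ᵐ x : Plane, ∀ v ∈ S, ∀ w ∈ S, w ≠ v → cp v w x ≠ 0 := by
    refine hall fun v _ => hall fun w _ => ?_
    by_cases h : w = v
    · exact Filter.Eventually.of_forall fun x h' => absurd h h'
    · filter_upwards [ae_cp_ne h 0] with x hx _ using by simpa using hx
  filter_upwards [h1, h2, h3, h4, h5] with x h1 h2 h3 h4 h5
  exact ⟨h1, h2, h3, fun v hv w hw hwv u hu => h4 v hv w hw u hu hwv, h5⟩

open Classical in
-- The ray reaches the bisector with `p` after the multiple `|p - v|² / (2 dp v p x)` of `x - v`, so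
-- the exit is given by the largest `dp v p x / |p - v|²`; genericity makes the maximizer unique.
-- The cell condition says that all ratios are at most `1/2`. If none is positive, the ray never
-- leaves.
theorem sum_exitsThrough {S : Finset Plane} {v x : Plane} (hx : Generic S x) (hv : v ∈ S) :
    ∑ w ∈ S, (if ExitsThrough S v w x then (1 : ℝ) else 0)
      = (if ∀ p ∈ S, 2 * dp v p x ≤ dp v p p then 1 else 0)
        - (if ∀ p ∈ S, dp v p x ≤ 0 then 1 else 0) := by
  have hself : dp v v x = 0 := by unfold dp; ring
  have hself' : dp v v v = 0 := by unfold dp; ring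
  by_cases hnc : ∀ p ∈ S, dp v p x ≤ 0
  · rw [if_pos hnc, if_pos fun p hp => by linarith [hnc p hp, dp_self_nonneg v p], sub_self]
    exact Finset.sum_eq_zero fun w hw => if_neg fun h => absurd h.1 (hnc w hw).not_gt
  rw [if_neg hnc, sub_zero]
  by_cases hcell : ∀ p ∈ S, 2 * dp v p x ≤ dp v p p
  · rw [if_pos hcell]
    push Not at hnc
    obtain ⟨p₀, hp₀, hpos⟩ := hnc
    have hp₀v : p₀ ≠ v := fun h => by rw [h, hself] at hpos; exact lt_irrefl _ hpos
    obtain ⟨w, hw, hmax⟩ := Finset.exists_max_image (S.erase v) (fun p => dp v p x / dp v p p)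
      ⟨p₀, Finset.mem_erase.mpr ⟨hp₀v, hp₀⟩⟩
    rw [Finset.mem_erase] at hw
    have hc := dp_self_pos hw.1
    have hle : ∀ p ∈ S, dp v p x * dp v w w ≤ dp v w x * dp v p p := fun p hp => by
      by_cases hpv : p = v
      · rw [hpv, hself, hself']; simp
      · have := hmax p (Finset.mem_erase.mpr ⟨hpv, hp⟩)
        rwa [div_le_div_iff₀ (dp_self_pos hpv) hc] at this
    have hw0 : 0 < dp v w x := by
      have := hle p₀ hp₀
      have h2 : 0 < dp v w x * dp v p₀ p₀ := (mul_pos hpos hc).trans_le this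
      exact pos_of_mul_pos_left h2 (dp_self_nonneg _ _)
    have hE : ExitsThrough S v w x :=
      ⟨hw0, lt_of_le_of_ne (hcell w hw.2) (hx.bisector v hv w hw.2 hw.1), hle⟩
    rw [Finset.sum_eq_single_of_mem w hw.2, if_pos hE]
    intro p hp hpw
    refine if_neg fun h => ?_
    have hpv : p ≠ v := fun h' => by
      have := h.1; rw [h', hself] at this; exact lt_irrefl _ this
    exact hx.ray v hv w hw.2 p hp hw.1 hpv hpw (le_antisymm (hle p hp) (h.2.2 w hw.2))
  · rw [if_neg hcell]
    refine Finset.sum_eq_zero fun w hw => if_neg fun h => hcell fun p hp => ?_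
    have hc : 0 < dp v w w := by linarith [h.1, h.2.1]
    refine le_of_mul_le_mul_right (a := dp v w w) ?_ hc
    have := h.2.2 p hp
    nlinarith [h.2.1, dp_self_nonneg v p]

open Classical in
theorem sum_cell {S : Finset Plane} {x n : Plane} (hx : Generic S x)
    (hn : IsNearest (S : Set Plane) x n) :
    ∑ v ∈ S, dp v x x * (if ∀ p ∈ S, 2 * dp v p x ≤ dp v p p then (1 : ℝ) else 0)
      = dist x n ^ 2 := by
  have hid : ∀ v p : Plane, dp p x x - dp v x x = dp v p p - 2 * dp v p x := fun v p => by
    unfold dp; ring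
  have hnS : n ∈ S := hn.1
  have hcell : ∀ p ∈ S, 2 * dp n p x ≤ dp n p p := fun p hp => by
    have := (dist_le_dist_iff x n p).mp (hn.2 p hp)
    linarith [hid n p]
  rw [Finset.sum_eq_single_of_mem n hnS, if_pos hcell, mul_one, dist_sq_eq]
  intro v hv hvn
  rw [if_neg, mul_zero]
  intro h
  refine hx.bisector n hnS v hv hvn ?_
  have h1 := h n hnS
  have h2 := hcell v hv
  linarith [hid n v, hid v n]

open Classical in
-- The nearest hull point `q` is unique. It is either a point of `S`, whose normal cone alone
-- counts, or an inner point of one edge, for which exactly one ordered pair counts.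
theorem sum_faces {S : Finset Plane} {x : Plane} (hne : S.Nonempty) (hx : Generic S x)
    (nv : Plane) (hnv : x ∉ hull S → IsNearest (visibleVertices S x) x nv) :
    ∑ v ∈ S, dp v x x * ((if ∀ p ∈ S, dp v p x ≤ 0 then (1 : ℝ) else 0)
        + ∑ w ∈ S, if ProjectsNear S v w x then (1 : ℝ) else 0)
      = if x ∈ hull S then 0 else dist x nv ^ 2 := by
  by_cases hxH : x ∈ hull S
  · rw [if_pos hxH]
    refine Finset.sum_eq_zero fun v hv => ?_
    rw [if_neg fun h => hx.ne v hv (eq_of_mem_hull_of_dp_nonpos h hxH), Finset.sum_eq_zero]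
    · simp
    · exact fun w _ => if_neg fun h => notMem_hull_of_facesEdge h.1 hxH
  rw [if_neg hxH]
  obtain ⟨q, hq, hproj⟩ := exists_projection hne x
  have hxq : x ≠ q := fun h => hxH (h ▸ hq)
  have hnear : ∀ v, IsNearest (visibleVertices S x) x v → dp v x x = dist x nv ^ 2 := fun v hv => by
    rw [dist_sq_eq]
    exact le_antisymm ((dist_le_dist_iff _ _ _).mp (hv.2 nv (hnv hxH).1))
      ((dist_le_dist_iff _ _ _).mp ((hnv hxH).2 v hv.1))
  have hncq : ∀ v ∈ S, (∀ p ∈ S, dp v p x ≤ 0) → v = q := fun v hv h => by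
    have h1 := dp_nonpos_of_mem_hull h hq
    have h2 := hproj v hv
    refine eq_of_dp_self_le ?_
    have : dp q v v = dp v q x + dp q x v := by unfold dp; ring
    linarith
  obtain ⟨v, hv, hface⟩ := exists_face hne hxH
  rcases hface with hnc | ⟨w, hw, hF, hd0, hd1⟩
  · have hvq := hncq v hv hnc
    have hno : ∀ v' ∈ S, ∀ w' ∈ S, ¬ ProjectsNear S v' w' x := fun v' hv' w' hw' h => by
      obtain ⟨-, -, h3, -, h5⟩ := h.projection hv' hw' hq hproj
      have z1 : dp q x v = 0 := by rw [hvq]; unfold dp; ring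
      have z2 : cp q x v = 0 := by rw [hvq]; unfold cp; ring
      have := h5 v hv z1
      rw [z2] at this
      linarith
    rw [Finset.sum_eq_single_of_mem v hv, if_pos hnc, Finset.sum_eq_zero, add_zero, mul_one]
    · exact hnear v (isNearest_visible_of_dp_nonpos hv (hx.ne v hv) hnc)
    · exact fun w hw => if_neg (hno v hv w hw)
    · intro v' hv' hvv
      rw [if_neg fun h => hvv ((hncq v' hv' h).trans hvq.symm), Finset.sum_eq_zero]
      · simp
      · exact fun w hw => if_neg (hno v' hv' w hw)
  · have hwv : w ≠ v := fun h => by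
      subst h
      apply hF.1
      unfold cp; ring
    have hP : ProjectsNear S v w x :=
      ⟨hF, hd0, lt_of_le_of_ne hd1 (hx.bisector v hv w hw hwv)⟩
    obtain ⟨h1, h2, h3, h4, h5⟩ := hP.projection hv hw hq hproj
    have hno : ∀ v' ∈ S, ¬ ∀ p ∈ S, dp v' p x ≤ 0 := fun v' hv' h => by
      have hvq := hncq v' hv' h
      have z1 : dp q x v' = 0 := by rw [hvq]; unfold dp; ring
      have z2 : cp q x v' = 0 := by rw [hvq]; unfold cp; ring
      have := h5 v' hv' z1
      rw [z2] at this
      linarith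
    have huniq : ∀ v' ∈ S, ∀ w' ∈ S, ProjectsNear S v' w' x → v' = v ∧ w' = w :=
      fun v' hv' w' hw' h => by
        obtain ⟨k1, k2, k3, k4, k5⟩ := h.projection hv' hw' hq hproj
        obtain ⟨e1, e2⟩ := eq_of_interlaced h3 h4 k3 k4 (h5 v' hv' k1) (h5 w' hw' k2)
          (k5 v hv h1) (k5 w hw h2)
        exact ⟨eq_of_dp_cp_eq hxq (k1.trans h1.symm) e1.symm,
          eq_of_dp_cp_eq hxq (k2.trans h2.symm) e2.symm⟩
    rw [Finset.sum_eq_single_of_mem v hv, if_neg (hno v hv), Finset.sum_eq_single_of_mem w hw,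
      if_pos hP, zero_add, mul_one]
    · exact hnear v (isNearest_visible_of_facesEdge hv hw hF hd0 hd1)
    · exact fun w' hw' hne => if_neg fun h => hne (huniq v hv w' hw' h).2
    · intro v' hv' hne
      rw [if_neg (hno v' hv'), Finset.sum_eq_zero]
      · simp
      · exact fun w' hw' => if_neg fun h => hne (huniq v' hv' w' hw' h).1

open Classical in
/-- The integrand as a sum over pairs of points. -/
theorem cellIntegrand_eq_sum {S : Finset Plane} (hne : S.Nonempty) {N NV : Plane → Plane}
    {x : Plane} (hx : Generic S x) (hN : IsNearest (S : Set Plane) x (N x))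
    (hNV : x ∉ hull S → IsNearest (visibleVertices S x) x (NV x)) :
    cellIntegrand S N NV x = ∑ v ∈ S, ∑ w ∈ S, dp v x x *
      ((if ExitsThrough S v w x then (1 : ℝ) else 0)
        - (if ProjectsNear S v w x then (1 : ℝ) else 0)) := by
  unfold cellIntegrand
  rw [← sum_cell hx hN, ← sum_faces hne hx (NV x) hNV, ← Finset.sum_sub_distrib]
  refine Finset.sum_congr rfl fun v hv => ?_
  -- The normal-cone indicators from `sum_exitsThrough` and `sum_faces` cancel here.
  rw [← Finset.mul_sum, Finset.sum_sub_distrib, sum_exitsThrough hx hv]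
  ring

/-! ### Delaunay triples as ends of Voronoi edges. -/

/-- The parameter of the circumcenter of `v w u` on the perpendicular bisector of `v` and `w`. -/
def centerParam (v w u : Plane) : ℝ := dp u v w / (2 * cp v w u)

/-- The point with parameter `s` on the perpendicular bisector of `v` and `w`. -/
def bisectorPoint (v w : Plane) (s : ℝ) : Plane :=
  !₂[(v 0 + w 0) / 2 - s * (w 1 - v 1), (v 1 + w 1) / 2 + s * (w 0 - v 0)]

/-- Along the bisector, the difference of the squared distances to `p` and to `v` is affine in `s`;
thus the Voronoi edge is a polyhedron in `ℝ`. -/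
theorem dp_bisectorPoint (v w p : Plane) (s : ℝ) :
    dp (bisectorPoint v w s) p p
      = dp (bisectorPoint v w s) v v + (dp p v w - 2 * cp v w p * s) := by
  simp only [bisectorPoint, dp, cp, Matrix.cons_val_zero, Matrix.cons_val_one]
  ring

/-- Positively oriented Delaunay triangles, as triples of vertices. -/
structure DelaunayTriple (S : Finset Plane) (v w u : Plane) : Prop where
  left_mem : v ∈ S
  mid_mem : w ∈ S
  right_mem : u ∈ S
  pos : 0 < cp v w u
  -- Division-free form of the empty circumcircle condition.
  empty : ∀ p ∈ S, cp v w p * dp u v w ≤ dp p v w * cp v w u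

theorem DelaunayTriple.rotate {S : Finset Plane} {v w u : Plane} (h : DelaunayTriple S v w u) :
    DelaunayTriple S w u v := by
  refine ⟨h.mid_mem, h.right_mem, h.left_mem, ?_, fun p hp => ?_⟩
  · have : cp w u v = cp v w u := by unfold cp; ring
    rw [this]; exact h.pos
  · have : dp p w u * cp w u v - cp w u p * dp v w u
        = dp p v w * cp v w u - cp v w p * dp u v w := by unfold cp dp; ring
    linarith [h.empty p hp]

theorem cp_swap (v w p : Plane) : cp w v p = -cp v w p := by unfold cp; ring

theorem centerParam_swap (v w u : Plane) : centerParam w v u = -centerParam v w u := by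
  unfold centerParam
  rw [cp_swap, dp_comm u w v, mul_neg, div_neg]

theorem DelaunayTriple.ne {S : Finset Plane} {v w u : Plane} (h : DelaunayTriple S v w u) :
    w ≠ v ∧ u ≠ v ∧ u ≠ w := by
  have hp := h.pos
  refine ⟨?_, ?_, ?_⟩ <;> rintro rfl <;> unfold cp at hp <;> nlinarith

/-- Each of two apexes is outside or on the circle of the other, so all four points would be
cocircular. -/
theorem DelaunayTriple.unique {S : Finset Plane} (hgen : GeneralPosition S) {v w u u' : Plane}
    (h : DelaunayTriple S v w u) (h' : DelaunayTriple S v w u') : u = u' := by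
  classical
  by_contra hne
  have hn := h.ne
  have hn' := h'.ne
  refine hgen {v, w, u, u'} ?_ ?_ ⟨bisectorPoint v w (centerParam v w u),
    dist v (bisectorPoint v w (centerParam v w u)), ?_⟩
  · simp [Finset.insert_subset_iff, h.left_mem, h.mid_mem, h.right_mem, h'.right_mem]
  · rw [Finset.card_insert_of_notMem, Finset.card_insert_of_notMem, Finset.card_pair hne]
    · simp [hn.2.2.symm, hn'.2.2.symm]
    · simp [hn.1.symm, hn.2.1.symm, hn'.2.1.symm]
  · have hp := h.pos
    have key : ∀ p, dp p v w * cp v w u = cp v w p * dp u v w →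
        dist p (bisectorPoint v w (centerParam v w u))
          = dist v (bisectorPoint v w (centerParam v w u)) := fun p hp' => by
      rw [← sq_eq_sq₀ dist_nonneg dist_nonneg, dist_sq_eq, dist_sq_eq, dp_bisectorPoint v w p]
      have : dp p v w - 2 * cp v w p * centerParam v w u = 0 := by
        unfold centerParam
        field_simp
        linarith
      rw [this, add_zero]
    intro p hpm
    simp only [Finset.coe_insert, Finset.coe_singleton, mem_insert_iff, mem_singleton_iff] at hpm
    rcases hpm with rfl | rfl | rfl | rfl
    · rfl
    · exact key _ (by unfold dp cp; ring)
    · exact key _ (by ring)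
    · exact key _ (le_antisymm (by linarith [h'.empty u h.right_mem]) (h.empty _ h'.right_mem))

/-- The circumcenter is the point of the bisector where the constraint of `u` is an equality; if
feasible, with positive slope, it is the upper end of the Voronoi edge. -/
theorem delaunayTriple_iff {S : Finset Plane} {v w u : Plane} (hv : v ∈ S) (hw : w ∈ S)
    (hu : u ∈ S) : DelaunayTriple S v w u ↔ 0 < 2 * cp v w u ∧
      Feasible S (fun p => 2 * cp v w p) (fun p => dp p v w) (dp u v w / (2 * cp v w u)) := by
  constructor
  · intro h
    have hp := h.pos
    refine ⟨by linarith, fun p hp' => ?_⟩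
    have := h.empty p hp'
    rw [← mul_div_assoc, div_le_iff₀ (by linarith)]
    linarith
  · rintro ⟨h1, h2⟩
    refine ⟨hv, hw, hu, by linarith, fun p hp => ?_⟩
    have := h2 p hp
    rw [← mul_div_assoc, div_le_iff₀ h1] at this
    linarith

theorem delaunayTriple_swap_iff {S : Finset Plane} {v w u : Plane} (hv : v ∈ S) (hw : w ∈ S)
    (hu : u ∈ S) : DelaunayTriple S w v u ↔ 2 * cp v w u < 0 ∧
      Feasible S (fun p => 2 * cp v w p) (fun p => dp p v w) (dp u v w / (2 * cp v w u)) := by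
  rw [delaunayTriple_iff hw hv hu, ← feasible_neg_iff (t := dp u v w / (2 * cp v w u))]
  simp only [cp_swap v w, mul_neg, dp_comm _ w v, div_neg, Left.neg_pos_iff]

theorem flag_eq_zero {v w x : Plane} {s : ℝ} (h : ¬ (0 < dp v w x ∧ 2 * dp v w x < dp v w w)) :
    flag v w s x = 0 := by
  unfold flag flagDensity
  refine indicator_of_notMem (fun hm => h ⟨hm.1, ?_⟩) _
  have := hm.2
  simp only at this
  linarith

theorem flag_eq {v w x : Plane} {s : ℝ} (h0 : 0 < dp v w x) (h1 : 2 * dp v w x < dp v w w) :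
    flag v w s x = signedInterval s (cp v w x / (2 * dp v w x)) * dp v x x := by
  unfold flag flagDensity
  have hm : dp v w x ∈ Ioo 0 (dp v w w / 2) := ⟨h0, by linarith⟩
  have hc : dp v w w ≠ 0 := by linarith
  simp only [indicator_of_mem hm]
  rw [dp_sq_add_cp_sq, mul_div_cancel_left₀ _ hc]

open Classical in
theorem pair_eq_flags {S : Finset Plane} (hgen : GeneralPosition S) {v w x : Plane} (hv : v ∈ S)
    (hw : w ∈ S) (hwv : w ≠ v) (hx : Generic S x) :
    dp v x x * ((if ExitsThrough S v w x then (1 : ℝ) else 0)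
        - (if ProjectsNear S v w x then (1 : ℝ) else 0))
      = ∑ u ∈ S with DelaunayTriple S v w u, flag v w (centerParam v w u) x
        - ∑ u ∈ S with DelaunayTriple S w v u, flag v w (centerParam v w u) x := by
  by_cases hadj : 0 < dp v w x ∧ 2 * dp v w x < dp v w w
  swap
  · rw [if_neg fun h => hadj ⟨h.1, h.2.1⟩, if_neg fun h => hadj h.2]
    simp [flag_eq_zero hadj]
  obtain ⟨h0, h1⟩ := hadj
  have hX := hx.cp_ne v hv w hw hwv
  -- The ray from `v` through `x` meets the bisector at `bisectorPoint v w t`.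
  set t := cp v w x / (2 * dp v w x) with ht
  have ht0 : t ≠ 0 := div_ne_zero hX (by linarith)
  have h2 : 0 < 2 * dp v w x := by linarith
  have key := sum_signedInterval (J := S) (β := fun p => 2 * cp v w p) (γ := fun p => dp p v w)
    (fun i hi j hj hbi hbj hfi hfj => DelaunayTriple.unique hgen
      ((delaunayTriple_iff hv hw hi).mpr ⟨hbi, hfi⟩) ((delaunayTriple_iff hv hw hj).mpr ⟨hbj, hfj⟩))
    (fun i hi j hj hbi hbj hfi hfj => DelaunayTriple.unique hgen
      ((delaunayTriple_swap_iff hv hw hi).mpr ⟨hbi, hfi⟩)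
      ((delaunayTriple_swap_iff hv hw hj).mpr ⟨hbj, hfj⟩)) ht0
  have hE : ExitsThrough S v w x ↔
      Feasible S (fun p => 2 * cp v w p) (fun p => dp p v w) t := by
    have hid : ∀ p, dp p v w * dp v w x - cp v w p * cp v w x
        = dp v w x * dp v p p - dp v p x * dp v w w := fun p => by unfold dp cp; ring
    have : ∀ p, 2 * cp v w p * t ≤ dp p v w ↔ dp v p x * dp v w w ≤ dp v w x * dp v p p :=
      fun p => by
        rw [ht, ← mul_div_assoc, div_le_iff₀ h2]
        constructor <;> intro h <;> linarith [hid p]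
    simp only [ExitsThrough, h0, h1, true_and, Feasible, this]
  have hP : ProjectsNear S v w x ↔
      FeasibleAtTop S (fun p => 2 * cp v w p) (fun p => dp p v w) ∧ 0 < t ∨
        FeasibleAtTop S (fun p => -(2 * cp v w p)) (fun p => dp p v w) ∧ t < 0 := by
    simp only [ProjectsNear, h0, h1, and_true, FacesEdge, ne_eq, hX, not_false_eq_true, true_and,
      FeasibleAtTop, neg_eq_zero, mul_eq_zero, OfNat.ofNat_ne_zero, false_or]
    rcases lt_or_gt_of_ne hX with hneg | hpos
    · have htn : t < 0 := div_neg_of_neg_of_pos hneg h2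
      simp only [htn, htn.not_gt, and_false, and_true, false_or]
      refine forall₂_congr fun p _ => and_congr_left' ⟨fun h => ?_, fun h => ?_⟩
      · by_contra! hcon
        nlinarith [mul_pos_of_neg_of_neg (show cp v w p < 0 by linarith) hneg]
      · exact mul_nonpos_of_nonneg_of_nonpos (by linarith) hneg.le
    · have htp : 0 < t := div_pos hpos h2
      simp only [htp, htp.not_gt, and_false, and_true, or_false]
      refine forall₂_congr fun p _ => and_congr_left' ⟨fun h => ?_, fun h => ?_⟩
      · by_contra! hcon
        nlinarith [mul_pos (show 0 < cp v w p by linarith) hpos]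
      · exact mul_nonpos_of_nonpos_of_nonneg (by linarith) hpos.le
  have e1 : ∑ u ∈ S with DelaunayTriple S v w u, flag v w (centerParam v w u) x
      = dp v x x * ∑ u ∈ S with 0 < 2 * cp v w u ∧ Feasible S (fun p => 2 * cp v w p)
        (fun p => dp p v w) (dp u v w / (2 * cp v w u)),
          signedInterval (dp u v w / (2 * cp v w u)) t := by
    rw [Finset.mul_sum]
    refine Finset.sum_congr (Finset.filter_congr fun u hu => delaunayTriple_iff hv hw hu)
      fun u _ => ?_
    rw [flag_eq h0 h1, mul_comm]; rfl
  have e2 : ∑ u ∈ S with DelaunayTriple S w v u, flag v w (centerParam v w u) x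
      = - (dp v x x * ∑ u ∈ S with 2 * cp v w u < 0 ∧ Feasible S (fun p => 2 * cp v w p)
        (fun p => dp p v w) (dp u v w / (2 * cp v w u)),
          signedInterval (-(dp u v w / (2 * cp v w u))) (-t)) := by
    rw [Finset.mul_sum, ← Finset.sum_neg_distrib]
    refine Finset.sum_congr (Finset.filter_congr fun u hu => delaunayTriple_swap_iff hv hw hu)
      fun u hu => ?_
    have hts : t ≠ dp u v w / (2 * cp v w u) := fun h => by
      refine hx.line v hv w hw hwv u (Finset.mem_filter.mp hu).1 ?_
      rw [← h, ht]; field_simp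
    rw [flag_eq h0 h1, signedInterval_neg ht0 hts]
    simp only [centerParam, ht]; ring
  rw [e1, e2, sub_neg_eq_add, ← mul_add, ← key]
  simp only [hE, hP]

/-! ### Integration of the flag decomposition. -/

open Classical in
theorem cellIntegrand_ae_eq {S : Finset Plane} (hne : S.Nonempty) (hgen : GeneralPosition S)
    {N NV : Plane → Plane} (hN : ∀ x, IsNearest (S : Set Plane) x (N x))
    (hNV : ∀ x, x ∉ hull S → IsNearest (visibleVertices S x) x (NV x)) :
    cellIntegrand S N NV =ᵐ[volume] fun x => ∑ v ∈ S, ∑ w ∈ S.erase v,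
      (∑ u ∈ S with DelaunayTriple S v w u, flag v w (centerParam v w u) x
        - ∑ u ∈ S with DelaunayTriple S w v u, flag v w (centerParam v w u) x) := by
  filter_upwards [ae_generic S] with x hx
  rw [cellIntegrand_eq_sum hne hx (hN x) (hNV x)]
  refine Finset.sum_congr rfl fun v hv => ?_
  rw [← Finset.add_sum_erase S _ hv]
  have hvv : dp v v x = 0 := by unfold dp; ring
  rw [if_neg fun h => h.1.ne' hvv, if_neg fun h => h.2.1.ne' hvv, sub_zero, mul_zero, zero_add]
  refine Finset.sum_congr rfl fun w hw => ?_
  rw [Finset.mem_erase] at hw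
  exact pair_eq_flags hgen hv hw.2 hw.1 hx

theorem integrable_cellIntegrand {S : Finset Plane} (hne : S.Nonempty) (hgen : GeneralPosition S)
    {N NV : Plane → Plane} (hN : ∀ x, IsNearest (S : Set Plane) x (N x))
    (hNV : ∀ x, x ∉ hull S → IsNearest (visibleVertices S x) x (NV x)) :
    Integrable (cellIntegrand S N NV) := by
  refine (integrable_congr (cellIntegrand_ae_eq hne hgen hN hNV)).mpr ?_
  refine integrable_finsetSum _ fun v _ => integrable_finsetSum _ fun w hw => ?_
  have hwv := (Finset.mem_erase.mp hw).1
  exact (integrable_finsetSum _ fun u _ => integrable_flag hwv _).sub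
    (integrable_finsetSum _ fun u _ => integrable_flag hwv _)

/-- The contribution of the edge from `v` to `w` to the Voronoi functional of the positively oriented
triangle `v w u`. -/
def edgeTerm (v w u : Plane) : ℝ := dp v w w ^ 2 / 16 * cubic (centerParam v w u)

open Classical in
-- The flags of a triple at the two ends of the edge `[v, w]` have equal integrals: swapping `v` and
-- `w` negates the parameter and `cubic` is odd, which absorbs the sign in the decomposition.
theorem integral_cellIntegrand {S : Finset Plane} (hne : S.Nonempty) (hgen : GeneralPosition S)
    {N NV : Plane → Plane} (hN : ∀ x, IsNearest (S : Set Plane) x (N x))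
    (hNV : ∀ x, x ∉ hull S → IsNearest (visibleVertices S x) x (NV x)) :
    ∫ x, cellIntegrand S N NV x
      = ∑ v ∈ S, ∑ w ∈ S, ∑ u ∈ S with DelaunayTriple S v w u, edgeTerm v w u := by
  rw [integral_congr_ae (cellIntegrand_ae_eq hne hgen hN hNV)]
  have hpair : ∀ v, ∀ w ∈ S.erase v, Integrable fun x =>
      (∑ u ∈ S with DelaunayTriple S v w u, flag v w (centerParam v w u) x
        - ∑ u ∈ S with DelaunayTriple S w v u, flag v w (centerParam v w u) x) := fun v w hw => by
    have hwv := (Finset.mem_erase.mp hw).1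
    exact (integrable_finsetSum _ fun u _ => integrable_flag hwv _).sub
      (integrable_finsetSum _ fun u _ => integrable_flag hwv _)
  rw [integral_finsetSum _ fun v _ => integrable_finsetSum _ (hpair v)]
  have h1 : ∀ v ∈ S, ∫ x, ∑ w ∈ S.erase v,
      (∑ u ∈ S with DelaunayTriple S v w u, flag v w (centerParam v w u) x
        - ∑ u ∈ S with DelaunayTriple S w v u, flag v w (centerParam v w u) x)
      = ∑ w ∈ S, (∑ u ∈ S with DelaunayTriple S v w u, edgeTerm v w u / 2
        + ∑ u ∈ S with DelaunayTriple S w v u, edgeTerm w v u / 2) := fun v hv => by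
    rw [integral_finsetSum _ (hpair v), ← Finset.add_sum_erase S _ hv]
    have hempty : S.filter (fun u => DelaunayTriple S v v u) = ∅ :=
      Finset.filter_eq_empty_iff.mpr fun u _ h => h.ne.1 rfl
    rw [hempty, Finset.sum_empty, add_zero, zero_add]
    refine Finset.sum_congr rfl fun w hw => ?_
    have hwv := (Finset.mem_erase.mp hw).1
    rw [integral_sub (integrable_finsetSum _ fun u _ => integrable_flag hwv _)
      (integrable_finsetSum _ fun u _ => integrable_flag hwv _),
      integral_finsetSum _ (fun u _ => integrable_flag hwv _),
      integral_finsetSum _ (fun u _ => integrable_flag hwv _), sub_eq_add_neg,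
      ← Finset.sum_neg_distrib]
    simp only [integral_flag hwv]
    congr 1 <;> refine Finset.sum_congr rfl fun u _ => ?_
    · unfold edgeTerm; ring
    · have : dp w v v = dp v w w := by unfold dp; ring
      unfold edgeTerm cubic
      rw [centerParam_swap v w u, this]; ring
  rw [Finset.sum_congr rfl h1]
  simp only [Finset.sum_add_distrib]
  rw [Finset.sum_comm (f := fun v w => ∑ u ∈ S with DelaunayTriple S w v u, edgeTerm w v u / 2)]
  simp only [← Finset.sum_add_distrib, add_halves]

/-! ### Triangles, circumcircles and Delaunay triangles in coordinates. -/

theorem dp_pos_of_angle_lt {v u w : Plane} (h : ∠ v u w < Real.pi / 2) : 0 < dp u v w := by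
  unfold EuclideanGeometry.angle InnerProductGeometry.angle at h
  rw [Real.arccos_lt_pi_div_two] at h
  have h1 : 0 < inner ℝ (v -ᵥ u) (w -ᵥ u) := by
    by_contra! hcon
    exact absurd h (div_nonpos_of_nonpos_of_nonneg hcon (by positivity)).not_gt
  rw [PiLp.inner_apply] at h1
  simp only [vsub_eq_sub, Fin.sum_univ_two, PiLp.sub_apply, RCLike.inner_apply,
    conj_trivial] at h1
  unfold dp; linarith

theorem collinear_iff_cp {v w u : Plane} (hwv : w ≠ v) :
    Collinear ℝ ({v, w, u} : Set Plane) ↔ cp v w u = 0 := by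
  rw [collinear_iff_of_mem (p₀ := v) (by simp)]
  constructor
  · rintro ⟨d, hd⟩
    obtain ⟨a, ha⟩ := hd w (by simp)
    obtain ⟨b, hb⟩ := hd u (by simp)
    rw [ha, hb]
    simp only [cp, vadd_eq_add, PiLp.add_apply, PiLp.smul_apply, smul_eq_mul]
    ring
  · intro h
    refine ⟨w - v, fun p hp => ?_⟩
    simp only [mem_insert_iff, mem_singleton_iff] at hp
    rcases hp with rfl | rfl | rfl
    · exact ⟨0, by simp⟩
    · exact ⟨1, by simp⟩
    · refine ⟨dp v w p / dp v w w, ?_⟩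
      have hc := dp_self_pos hwv
      refine eq_of_dp_cp_eq hwv ?_ ?_
      · have : ∀ r : ℝ, dp v w (r • (w - v) +ᵥ v) = r * dp v w w := fun r => by
          simp only [dp, vadd_eq_add, PiLp.add_apply, PiLp.smul_apply, PiLp.sub_apply, smul_eq_mul]
          ring
        rw [this]; field_simp
      · have : ∀ r : ℝ, cp v w (r • (w - v) +ᵥ v) = 0 := fun r => by
          simp only [cp, vadd_eq_add, PiLp.add_apply, PiLp.smul_apply, PiLp.sub_apply, smul_eq_mul]
          ring
        rw [this, h]

theorem affineIndependent_of_cp_ne {v w u : Plane} (h : cp v w u ≠ 0) :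
    AffineIndependent ℝ ![v, w, u] := by
  have hwv : w ≠ v := by
    rintro rfl
    apply h; unfold cp; ring
  rw [affineIndependent_iff_not_collinear_set, collinear_iff_cp hwv]
  exact h

/-- The triangle with vertices `v`, `w`, `u`. -/
def mkTriangle (v w u : Plane) (h : cp v w u ≠ 0) : Affine.Triangle ℝ Plane :=
  ⟨![v, w, u], affineIndependent_of_cp_ne h⟩

theorem cp_points_ne (T : Affine.Triangle ℝ Plane) :
    cp (T.points 0) (T.points 1) (T.points 2) ≠ 0 := by
  have hne : T.points 1 ≠ T.points 0 := fun h => by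
    simpa using T.independent.injective h
  rw [Ne, ← collinear_iff_cp hne, ← affineIndependent_iff_not_collinear_set]
  have : ![T.points 0, T.points 1, T.points 2] = T.points := by
    funext i
    fin_cases i <;> rfl
  rw [this]
  exact T.independent

theorem range_mkTriangle {v w u : Plane} (h : cp v w u ≠ 0) :
    Set.range (mkTriangle v w u h).points = {v, w, u} := by
  simp only [mkTriangle, Matrix.range_cons, Matrix.range_empty, singleton_union, insert_empty_eq]

theorem circumcenter_eq {T : Affine.Triangle ℝ Plane} {v w u : Plane} (h : cp v w u ≠ 0)
    (hT : Set.range T.points = {v, w, u}) :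
    T.circumcenter = bisectorPoint v w (centerParam v w u) ∧
      T.circumradius = dist v (bisectorPoint v w (centerParam v w u)) := by
  have htop : affineSpan ℝ (Set.range T.points) = ⊤ := by
    rw [T.independent.affineSpan_eq_top_iff_card_eq_finrank_add_one]
    simp
  have hr : ∀ i, dist (T.points i) (bisectorPoint v w (centerParam v w u))
      = dist v (bisectorPoint v w (centerParam v w u)) := fun i => by
    have hi : T.points i ∈ ({v, w, u} : Set Plane) := hT ▸ Set.mem_range_self i
    rw [← sq_eq_sq₀ dist_nonneg dist_nonneg, dist_sq_eq, dist_sq_eq, dp_bisectorPoint v w]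
    have : dp (T.points i) v w - 2 * cp v w (T.points i) * centerParam v w u = 0 := by
      simp only [mem_insert_iff, mem_singleton_iff] at hi
      rcases hi with hi | hi | hi <;> rw [hi]
      · unfold dp cp; ring
      · unfold dp cp; ring
      · unfold centerParam; field_simp; ring
    rw [this, add_zero]
  have hmem : bisectorPoint v w (centerParam v w u) ∈ affineSpan ℝ (Set.range T.points) := by
    rw [htop]; trivial
  exact ⟨(T.eq_circumcenter_of_dist_eq hmem hr).symm, (T.eq_circumradius_of_dist_eq hmem hr).symm⟩

theorem isDelaunay_iff {S : Finset Plane} {T : Affine.Triangle ℝ Plane} {v w u : Plane}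
    (h : 0 < cp v w u) (hT : Set.range T.points = {v, w, u}) :
    IsDelaunay S T ↔ DelaunayTriple S v w u := by
  obtain ⟨hcen, hrad⟩ := circumcenter_eq h.ne' hT
  have hp : ∀ p, T.circumradius ≤ dist p T.circumcenter ↔
      cp v w p * dp u v w ≤ dp p v w * cp v w u := fun p => by
    rw [hcen, hrad, ← sq_le_sq₀ dist_nonneg dist_nonneg, dist_sq_eq, dist_sq_eq,
      dp_bisectorPoint v w p, le_add_iff_nonneg_right]
    have : dp p v w - 2 * cp v w p * centerParam v w u
        = (dp p v w * cp v w u - cp v w p * dp u v w) / cp v w u := by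
      unfold centerParam; field_simp
    rw [this, le_div_iff₀ h, zero_mul, sub_nonneg]
  have hmem : (∀ i, T.points i ∈ S) ↔ v ∈ S ∧ w ∈ S ∧ u ∈ S := by
    have : (∀ i, T.points i ∈ S) ↔ ∀ p ∈ Set.range T.points, p ∈ S := by simp
    rw [this, hT]
    simp
  unfold IsDelaunay
  simp only [hp, hmem]
  exact ⟨fun h' => ⟨h'.1.1, h'.1.2.1, h'.1.2.2, h, h'.2⟩,
    fun h' => ⟨⟨h'.1, h'.2, h'.3⟩, h'.5⟩⟩

theorem exists_oriented (T : Affine.Triangle ℝ Plane) :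
    ∃ v w u, 0 < cp v w u ∧ Set.range T.points = {v, w, u} := by
  have hr : Set.range T.points = {T.points 0, T.points 1, T.points 2} := by
    ext p
    simp only [Set.mem_range, mem_insert_iff, mem_singleton_iff, Fin.exists_fin_succ,
      Fin.exists_fin_zero]
    simp [eq_comm]
  rcases lt_or_gt_of_ne (cp_points_ne T) with h | h
  · refine ⟨T.points 0, T.points 2, T.points 1, ?_, ?_⟩
    · have : cp (T.points 0) (T.points 2) (T.points 1)
          = - cp (T.points 0) (T.points 1) (T.points 2) := by unfold cp; ring
      rw [this]; linarith
    · rw [hr, Set.pair_comm]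
  · exact ⟨_, _, _, h, hr⟩

theorem mem_delaunay_iff {S t : Finset Plane} :
    t ∈ delaunay S ↔ ∃ v w u, DelaunayTriple S v w u ∧ (t : Set Plane) = {v, w, u} := by
  unfold delaunay
  simp only [Finset.mem_filter, Finset.mem_powerset]
  constructor
  · rintro ⟨-, T, hT, hr⟩
    obtain ⟨v, w, u, hpos, hvwu⟩ := exists_oriented T
    exact ⟨v, w, u, (isDelaunay_iff hpos hvwu).mp hT, hr.symm.trans hvwu⟩
  · rintro ⟨v, w, u, h, ht⟩
    refine ⟨fun p hp => ?_, mkTriangle v w u h.pos.ne',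
      (isDelaunay_iff h.pos (range_mkTriangle _)).mpr h, (range_mkTriangle _).trans ht.symm⟩
    have : p ∈ (t : Set Plane) := hp
    rw [ht] at this
    simp only [mem_insert_iff, mem_singleton_iff] at this
    rcases this with rfl | rfl | rfl
    exacts [h.left_mem, h.mid_mem, h.right_mem]

/-! ### Area of a triangle and the closed formula. -/

theorem measurableSet_standard_triangle (K : ℝ) :
    MeasurableSet {y : ℝ × ℝ | 0 ≤ y.1 ∧ 0 ≤ y.2 ∧ y.1 + y.2 ≤ K} :=
  ((isClosed_le continuous_const continuous_fst).inter
    ((isClosed_le continuous_const continuous_snd).inter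
      (isClosed_le (continuous_fst.add continuous_snd) continuous_const))).measurableSet

theorem volume_standard_triangle {K : ℝ} (hK : 0 ≤ K) :
    volume.real {y : ℝ × ℝ | 0 ≤ y.1 ∧ 0 ≤ y.2 ∧ y.1 + y.2 ≤ K} = K ^ 2 / 2 := by
  have hm := measurableSet_standard_triangle K
  rw [Measure.real, Measure.volume_eq_prod, Measure.prod_apply hm]
  have hslice : ∀ a : ℝ, volume (Prod.mk a ⁻¹' {y : ℝ × ℝ | 0 ≤ y.1 ∧ 0 ≤ y.2 ∧ y.1 + y.2 ≤ K})
      = (Icc 0 K).indicator (fun a => ENNReal.ofReal (K - a)) a := fun a => by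
    by_cases ha : a ∈ Icc 0 K
    · rw [indicator_of_mem ha]
      have : Prod.mk a ⁻¹' {y : ℝ × ℝ | 0 ≤ y.1 ∧ 0 ≤ y.2 ∧ y.1 + y.2 ≤ K} = Icc 0 (K - a) := by
        ext b
        simp only [mem_preimage, mem_ofPred_eq, ha.1, true_and, mem_Icc, le_sub_iff_add_le']
      rw [this, Real.volume_Icc, sub_zero]
    · rw [indicator_of_notMem ha]
      have : Prod.mk a ⁻¹' {y : ℝ × ℝ | 0 ≤ y.1 ∧ 0 ≤ y.2 ∧ y.1 + y.2 ≤ K} = ∅ := by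
        ext b
        simp only [mem_preimage, mem_ofPred_eq, mem_empty_iff_false, iff_false]
        exact fun h => ha ⟨h.1, by linarith [h.2.1, h.2.2]⟩
      rw [this, measure_empty]
  simp only [hslice]
  rw [lintegral_indicator measurableSet_Icc, ← ofReal_integral_eq_lintegral_ofReal,
    ENNReal.toReal_ofReal, integral_Icc_eq_integral_Ioc, ← intervalIntegral.integral_of_le hK]
  · rw [intervalIntegral.integral_sub (by simp) (by simp), intervalIntegral.integral_const,
      integral_id, smul_eq_mul]
    ring
  · exact setIntegral_nonneg measurableSet_Icc fun a ha => sub_nonneg.mpr ha.2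
  · exact (Continuous.integrableOn_Icc (by fun_prop))
  · filter_upwards [ae_restrict_mem measurableSet_Icc] with a ha using sub_nonneg.mpr ha.2

/-- The barycentric coordinates of `x` at `w` and `u` are `cp v x u / cp v w u` and `cp v w x / cp v
w u`. -/
theorem convexHull_triangle {v w u : Plane} (h : 0 < cp v w u) :
    convexHull ℝ ({v, w, u} : Set Plane)
      = {x | 0 ≤ cp v x u ∧ 0 ≤ cp v w x ∧ cp v x u + cp v w x ≤ cp v w u} := by
  have hid0 : cp v v u = 0 := by unfold cp; ring
  have hid1 : cp v w v = 0 := by unfold cp; ring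
  have hid2 : cp v u u = 0 := by unfold cp; ring
  have hid3 : cp v w w = 0 := by unfold cp; ring
  apply Subset.antisymm
  · refine convexHull_min ?_ ?_
    · rintro p hp
      simp only [mem_insert_iff, mem_singleton_iff] at hp
      rcases hp with rfl | rfl | rfl <;> simp [hid0, hid1, hid2, hid3, h.le]
    · intro x hx y hy a b ha hb hab
      simp only [mem_ofPred_eq] at hx hy ⊢
      have hb' : b = 1 - a := by linarith
      have e1 : cp v (a • x + b • y) u = a * cp v x u + b * cp v y u := by
        simp only [cp, PiLp.add_apply, PiLp.smul_apply, smul_eq_mul]; subst hb'; ring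
      have e2 : cp v w (a • x + b • y) = a * cp v w x + b * cp v w y := by
        simp only [cp, PiLp.add_apply, PiLp.smul_apply, smul_eq_mul]; subst hb'; ring
      rw [e1, e2]
      refine ⟨by nlinarith [mul_nonneg ha hx.1, mul_nonneg hb hy.1],
        by nlinarith [mul_nonneg ha hx.2.1, mul_nonneg hb hy.2.1], ?_⟩
      have := mul_le_mul_of_nonneg_left hx.2.2 ha
      have := mul_le_mul_of_nonneg_left hy.2.2 hb
      have : a * cp v w u + b * cp v w u = cp v w u := by rw [← add_mul, hab, one_mul]
      linarith
  · rintro x ⟨h0, h1, h2⟩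
    have hconv := convex_convexHull ℝ ({v, w, u} : Set Plane)
    have hmem : ∀ p ∈ ({v, w, u} : Set Plane), p ∈ convexHull ℝ ({v, w, u} : Set Plane) :=
      fun p hp => subset_convexHull ℝ _ hp
    have := hconv.sum_mem (t := Finset.univ (α := Fin 3))
      (w := ![1 - cp v x u / cp v w u - cp v w x / cp v w u, cp v x u / cp v w u,
        cp v w x / cp v w u]) (z := ![v, w, u]) (by
        intro i _
        fin_cases i
        · simp only [Fin.zero_eta, Matrix.cons_val_zero]
          rw [sub_sub, ← add_div, sub_nonneg]
          exact (div_le_one h).mpr h2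
        · exact div_nonneg h0 h.le
        · exact div_nonneg h1 h.le) (by simp [Fin.sum_univ_three]; ring) (by
        intro i _
        fin_cases i
        · exact hmem _ (by simp)
        · exact hmem _ (by simp)
        · exact hmem _ (by simp))
    convert this using 1
    simp only [Fin.sum_univ_three, Matrix.cons_val_zero, Matrix.cons_val_one, Matrix.cons_val]
    ext i
    have hc := h.ne'
    simp only [PiLp.add_apply, PiLp.smul_apply, smul_eq_mul]
    field_simp
    fin_cases i <;> simp only [cp, Fin.zero_eta, Fin.mk_one] <;> ring

theorem volume_triangle {v w u : Plane} (h : 0 < cp v w u) :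
    volume.real (convexHull ℝ ({v, w, u} : Set Plane)) = cp v w u / 2 := by
  have hdet : (u 1 - v 1) * (w 0 - v 0) - (-(u 0 - v 0)) * (-(w 1 - v 1)) = cp v w u := by
    unfold cp; ring
  have hmap := map_affine_volume v (u 1 - v 1) (-(u 0 - v 0)) (-(w 1 - v 1)) (w 0 - v 0)
    (by rw [hdet]; exact h.ne')
  have hm := measurableSet_standard_triangle (cp v w u)
  have hpre : convexHull ℝ ({v, w, u} : Set Plane)
      = (fun x : Plane => ((u 1 - v 1) * (x 0 - v 0) + (-(u 0 - v 0)) * (x 1 - v 1),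
        (-(w 1 - v 1)) * (x 0 - v 0) + (w 0 - v 0) * (x 1 - v 1))) ⁻¹'
        {y : ℝ × ℝ | 0 ≤ y.1 ∧ 0 ≤ y.2 ∧ y.1 + y.2 ≤ cp v w u} := by
    rw [convexHull_triangle h]
    ext x
    have e1 : (u 1 - v 1) * (x 0 - v 0) + (-(u 0 - v 0)) * (x 1 - v 1) = cp v x u := by
      unfold cp; ring
    have e2 : (-(w 1 - v 1)) * (x 0 - v 0) + (w 0 - v 0) * (x 1 - v 1) = cp v w x := by
      unfold cp; ring
    simp only [mem_preimage, mem_ofPred_eq, e1, e2]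
  rw [Measure.real, hpre, ← Measure.map_apply (by fun_prop) hm, hmap, hdet, Measure.smul_apply,
    smul_eq_mul, ENNReal.toReal_mul]
  have := volume_standard_triangle h.le
  rw [Measure.real] at this
  rw [this, ENNReal.toReal_ofReal (abs_nonneg _), abs_of_pos (inv_pos.mpr h)]
  field_simp

/-- The closed formula for the Voronoi functional is the sum of the edge terms. -/
theorem closed_formula {v w u : Plane} (h : 0 < cp v w u) :
    cp v w u / 2 / 12 * (dp u w w + dp v u u + dp w v v
        - 4 * dp (bisectorPoint v w (centerParam v w u)) v v)
      = edgeTerm v w u + edgeTerm w u v + edgeTerm u v w := by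
  have e1 : cp w u v = cp v w u := by unfold cp; ring
  have e2 : cp u v w = cp v w u := by unfold cp; ring
  have hR : dp (bisectorPoint v w (centerParam v w u)) v v
      = dp v w w * (1 / 4 + centerParam v w u ^ 2) := by
    simp only [bisectorPoint, dp, Matrix.cons_val_zero, Matrix.cons_val_one]
    ring
  rw [hR]
  unfold edgeTerm cubic centerParam
  have f1 : dp v w w = dp v w u + dp w u v := by unfold dp; ring
  have f2 : dp w u u = dp w u v + dp u v w := by unfold dp; ring
  have f3 : dp u v v = dp u v w + dp v w u := by unfold dp; ring
  have f4 : dp u w w = dp w u u := by unfold dp; ring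
  have f5 : dp v u u = dp u v v := by unfold dp; ring
  have f6 : dp w v v = dp v w w := by unfold dp; ring
  -- The parameters of the circumcenter are half the cotangents of the angles, and this is the
  -- relation that the pairwise products of the three cotangents sum to `1`. It leaves a polynomial
  -- identity in the inner products at the vertices.
  have hK2 : cp v w u ^ 2
      = dp v w u * dp w u v + dp w u v * dp u v w + dp u v w * dp v w u := by unfold dp cp; ring
  rw [e1, e2, f4, f5, f6, f1, f2, f3]
  generalize cp v w u = k at *
  generalize dp v w u = a at *
  generalize dp w u v = b at *
  generalize dp u v w = c at *
  have hk := h.ne'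
  have hl : k / 2 / 12 * (b + c + (c + a) + (a + b)
        - 4 * ((a + b) * (1 / 4 + (c / (2 * k)) ^ 2)))
      = 4 * k ^ 2 * (2 * (a + b + c) * k ^ 2 - (a + b) * (k ^ 2 + c ^ 2)) / (96 * k ^ 3) := by
    field_simp; ring
  have hr : (a + b) ^ 2 / 16 * (c / (2 * k) + 4 * (c / (2 * k)) ^ 3 / 3)
        + (b + c) ^ 2 / 16 * (a / (2 * k) + 4 * (a / (2 * k)) ^ 3 / 3)
        + (c + a) ^ 2 / 16 * (b / (2 * k) + 4 * (b / (2 * k)) ^ 3 / 3)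
      = ((a + b) ^ 2 * c * (3 * k ^ 2 + c ^ 2) + (b + c) ^ 2 * a * (3 * k ^ 2 + a ^ 2)
        + (c + a) ^ 2 * b * (3 * k ^ 2 + b ^ 2)) / (96 * k ^ 3) := by
    field_simp; ring
  rw [hl, hr, hK2]
  congr 1
  ring

/-! ### Existence of nearest points and the case of acute opposite angles. -/

theorem exists_isNearest {S : Finset Plane} (hne : S.Nonempty) (x : Plane) :
    ∃ p, IsNearest (S : Set Plane) x p := by
  obtain ⟨p, hp, hmin⟩ := S.exists_min_image (fun p => dist x p) hne
  exact ⟨p, hp, hmin⟩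

theorem exists_isNearest_visible {S : Finset Plane} (hne : S.Nonempty) {x : Plane}
    (hx : x ∉ hull S) : ∃ p, IsNearest (visibleVertices S x) x p := by
  obtain ⟨v, hv, hnc | ⟨w, hw, hF, h0, h1⟩⟩ := exists_face hne hx
  · exact ⟨v, isNearest_visible_of_dp_nonpos hv (fun h => hx (h ▸ mem_hull hv)) hnc⟩
  · exact ⟨v, isNearest_visible_of_facesEdge hv hw hF h0 h1⟩

/-- If the angles opposite to the hull edges are acute, no point of `S` lies inside the circle with
a hull edge as diameter. -/
theorem dp_nonneg_of_facesEdge {S : Finset Plane} (hacute : HullOppositeAnglesAcute S)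
    {v w x : Plane} (hv : v ∈ S) (hw : w ∈ S) (hF : FacesEdge S v w x) :
    ∀ p ∈ S, 0 ≤ dp p v w := by
  wlog hneg : cp v w x < 0 generalizing v w
  · intro p hp
    rw [dp_comm]
    refine this hw hv hF.symm ?_ p hp
    rw [cp_swap]
    exact neg_lt_zero.mpr (lt_of_le_of_ne (not_lt.mp hneg) hF.1.symm)
  have hcp : ∀ p ∈ S, 0 ≤ cp v w p := fun p hp => by
    by_contra! hcon
    exact absurd (mul_pos_of_neg_of_neg hcon hneg) (hF.2 p hp).1.not_gt
  classical
  intro p hp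
  rcases (hcp p hp).eq_or_lt with h0 | hpos
  · exact (hF.2 p hp).2 h0.symm
  -- The ratio is the cotangent of the angle under which `p` sees the edge. Its minimizer gives the
  -- Delaunay triangle on the edge, and acuteness there makes all the ratios positive.
  obtain ⟨u, hu, hmin⟩ := Finset.exists_min_image (S.filter fun p => 0 < cp v w p)
    (fun p => dp p v w / cp v w p) ⟨p, by simp [hp, hpos]⟩
  rw [Finset.mem_filter] at hu
  have hD : DelaunayTriple S v w u := by
    refine ⟨hv, hw, hu.1, hu.2, fun r hr => ?_⟩
    rcases (hcp r hr).eq_or_lt with h0 | hr0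
    · rw [← h0, zero_mul]
      exact mul_nonneg ((hF.2 r hr).2 h0.symm) hu.2.le
    · have := hmin r (by simp [hr, hr0])
      rw [div_le_div_iff₀ hu.2 hr0] at this
      linarith
  have hang := hacute (mkTriangle v w u hD.pos.ne')
    ((isDelaunay_iff hD.pos (range_mkTriangle _)).mpr hD) 0 1 2 (by decide) (by decide) (by decide)
    (hF.segment_subset_frontier hv hw)
  have hdp : 0 < dp u v w := dp_pos_of_angle_lt hang
  have := hD.empty p hp
  have h2 : 0 ≤ dp p v w * cp v w u := (mul_pos hpos hdp).le.trans this
  exact nonneg_of_mul_nonneg_left h2 hD.pos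

/-- By `exists_face` the nearest visible vertex may be taken as `v`. In the edge case, `dp p v w ≥
0` for all `p` says that the ray from `v` through `x` leaves the cell of `v` through the bisector
with `w`, which lies beyond `x` or contains it. -/
theorem isNearest_of_isNearest_visible {S : Finset Plane} (hne : S.Nonempty)
    (hacute : HullOppositeAnglesAcute S) {x n nv : Plane} (hx : x ∉ hull S)
    (hn : IsNearest (S : Set Plane) x n) (hnv : IsNearest (visibleVertices S x) x nv) :
    dist x n = dist x nv := by
  have hnear : ∀ v, IsNearest (visibleVertices S x) x v → (∀ p ∈ S, dist x v ≤ dist x p) →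
      dist x n = dist x nv := fun v hv h =>
    le_antisymm (hn.2 nv hnv.1.1.1) ((hnv.2 v hv.1).trans (h n hn.1))
  obtain ⟨v, hv, hnc | ⟨w, hw, hF, h0, h1⟩⟩ := exists_face hne hx
  · refine hnear v (isNearest_visible_of_dp_nonpos hv (fun h => hx (h ▸ mem_hull hv)) hnc)
      fun p hp => (dist_le_dist_iff _ _ _).mpr ?_
    have hid : dp p x x - dp v x x = dp v p p - 2 * dp v p x := by unfold dp; ring
    linarith [hnc p hp, dp_self_nonneg v p]
  · refine hnear v (isNearest_visible_of_facesEdge hv hw hF h0 h1)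
      fun p hp => (dist_le_dist_iff _ _ _).mpr ?_
    have hid : dp p x x - dp v x x = dp v p p - 2 * dp v p x := by unfold dp; ring
    have hid' : dp p v w * dp v w x - cp v w p * cp v w x
        = dp v w x * dp v p p - dp v p x * dp v w w := by unfold dp cp; ring
    have hc : 0 < dp v w w := by linarith
    have hp0 := dp_nonneg_of_facesEdge hacute hv hw hF p hp
    have hle : dp v p x * dp v w w ≤ dp v w x * dp v p p := by
      linarith [mul_nonneg hp0 h0.le, (hF.2 p hp).1]
    have : 2 * dp v p x ≤ dp v p p := by
      refine le_of_mul_le_mul_right (a := dp v w w) ?_ hc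
      nlinarith [dp_self_nonneg v p]
    linarith

theorem measurableSet_hull (S : Finset Plane) : MeasurableSet (hull S) :=
  (S.finite_toSet.isCompact_convexHull (𝕜 := ℝ)).isClosed.measurableSet

theorem integral_cellIntegrand_of_acute {S : Finset Plane} (hne : S.Nonempty)
    (hacute : HullOppositeAnglesAcute S) {N NV : Plane → Plane}
    (hN : ∀ x, IsNearest (S : Set Plane) x (N x))
    (hNV : ∀ x, x ∉ hull S → IsNearest (visibleVertices S x) x (NV x)) :
    ∫ x, cellIntegrand S N NV x = ∫ x in hull S, dist x (N x) ^ 2 := by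
  rw [← integral_indicator (measurableSet_hull S)]
  congr 1
  funext x
  by_cases hx : x ∈ hull S
  · simp [cellIntegrand, hx]
  · simp [cellIntegrand, hx, isNearest_of_isNearest_visible hne hacute hx (hN x) (hNV x hx)]

/-! ### Assembly over the Delaunay triangles. -/

/-- A positively oriented ordering of the vertices of a triangle is unique up to rotation. -/
theorem rotation_of_set_eq {v w u a b c : Plane} (h : 0 < cp v w u) (h' : 0 < cp a b c)
    (hset : ({a, b, c} : Set Plane) = {v, w, u}) :
    (a, b, c) = (v, w, u) ∨ (a, b, c) = (w, u, v) ∨ (a, b, c) = (u, v, w) := by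
  have z1 : ∀ p q : Plane, cp p p q = 0 := fun p q => by unfold cp; ring
  have z2 : ∀ p q : Plane, cp p q p = 0 := fun p q => by unfold cp; ring
  have z3 : ∀ p q : Plane, cp q p p = 0 := fun p q => by unfold cp; ring
  have s1 : cp v u w = -cp v w u := by unfold cp; ring
  have s2 : cp w v u = -cp v w u := by unfold cp; ring
  have s3 : cp u w v = -cp v w u := by unfold cp; ring
  have ha : a ∈ ({v, w, u} : Set Plane) := hset ▸ (by simp)
  have hb : b ∈ ({v, w, u} : Set Plane) := hset ▸ (by simp)
  have hc : c ∈ ({v, w, u} : Set Plane) := hset ▸ (by simp)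
  simp only [mem_insert_iff, mem_singleton_iff] at ha hb hc
  clear hset
  rcases ha with ha | ha | ha <;> rcases hb with hb | hb | hb <;>
    rcases hc with hc | hc | hc <;> rw [ha, hb, hc] at h' ⊢ <;>
    first
      | exact absurd h' (by simp only [z1, z2, z3, lt_irrefl, not_false_eq_true])
      | exact absurd h' (by simp only [s1, s2, s3]; linarith)
      | simp

open Classical in
/-- The sum of the edge terms over the positively oriented Delaunay triples with vertex set `t`. -/
theorem sum_edgeTerm_fiber {S t : Finset Plane} {v w u : Plane} (h : DelaunayTriple S v w u)
    (ht : (t : Set Plane) = {v, w, u}) :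
    ∑ y ∈ (S ×ˢ S ×ˢ S) with DelaunayTriple S y.1 y.2.1 y.2.2 ∧
        ({y.1, y.2.1, y.2.2} : Finset Plane) = t, edgeTerm y.1 y.2.1 y.2.2
      = edgeTerm v w u + edgeTerm w u v + edgeTerm u v w := by
  have hn := h.ne
  have hfib : ((S ×ˢ S ×ˢ S).filter fun y => DelaunayTriple S y.1 y.2.1 y.2.2 ∧
      ({y.1, y.2.1, y.2.2} : Finset Plane) = t) = {(v, w, u), (w, u, v), (u, v, w)} := by
    ext ⟨a, b, c⟩
    simp only [Finset.mem_filter, Finset.mem_product, Finset.mem_insert, Finset.mem_singleton]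
    constructor
    · rintro ⟨-, hD, hs⟩
      refine rotation_of_set_eq h.pos hD.pos ?_
      rw [← ht, ← hs]; simp
    · have hs : ∀ p q r : Plane, ({p, q, r} : Set Plane) = {v, w, u} →
          ({p, q, r} : Finset Plane) = t := fun p q r hpqr => by
        rw [← Finset.coe_inj, ht, ← hpqr]; simp
      have h2 := h.rotate
      have h3 := h2.rotate
      rintro (he | he | he) <;> simp only [Prod.mk.injEq] at he <;>
        obtain ⟨rfl, rfl, rfl⟩ := he
      · exact ⟨⟨h.1, h.2, h.3⟩, h, hs _ _ _ rfl⟩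
      · exact ⟨⟨h2.1, h2.2, h2.3⟩, h2, hs _ _ _ (by ext; simp; tauto)⟩
      · exact ⟨⟨h3.1, h3.2, h3.3⟩, h3, hs _ _ _ (by ext; simp; tauto)⟩
  rw [hfib, Finset.sum_insert, Finset.sum_insert, Finset.sum_singleton]
  · ring
  · simp [hn.2.2.symm]
  · simp [hn.1.symm, hn.2.1.symm]

open Classical in
theorem sum_edgeTerm_eq_sum_filter (S : Finset Plane) :
    ∑ v ∈ S, ∑ w ∈ S, ∑ u ∈ S with DelaunayTriple S v w u, edgeTerm v w u
      = ∑ y ∈ (S ×ˢ S ×ˢ S) with DelaunayTriple S y.1 y.2.1 y.2.2, edgeTerm y.1 y.2.1 y.2.2 := by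
  simp only [Finset.sum_filter, Finset.sum_product]

/-- The vertex set of an acute triangle satisfies the hypotheses of the acute case, has this
triangle as its only Delaunay triangle, and has it as hull; both evaluations of the integral are
then compared. -/
theorem voronoiTriangle_eq_of_acute {v w u : Plane} (h : 0 < cp v w u)
    (hac : (mkTriangle v w u h.ne').AcuteAngled) :
    voronoiTriangle (mkTriangle v w u h.ne')
      = edgeTerm v w u + edgeTerm w u v + edgeTerm u v w := by
  classical
  set T := mkTriangle v w u h.ne' with hT
  set S : Finset Plane := {v, w, u} with hS
  have hcoe : (S : Set Plane) = {v, w, u} := by simp [hS]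
  have hrange : Set.range T.points = (S : Set Plane) := by rw [hcoe]; exact range_mkTriangle _
  have hne : S.Nonempty := ⟨v, by simp [hS]⟩
  -- Vacuous, as there are only three points.
  have hgen : GeneralPosition S := fun t ht hcard => by
    have h1 := Finset.card_le_card ht
    have h2 : S.card ≤ 3 := Finset.card_le_three
    omega
  have hD : DelaunayTriple S v w u := by
    refine ⟨by simp [hS], by simp [hS], by simp [hS], h, fun p hp => le_of_eq ?_⟩
    simp only [hS, Finset.mem_insert, Finset.mem_singleton] at hp
    rcases hp with rfl | rfl | rfl
    · unfold cp dp; ring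
    · unfold cp dp; ring
    · ring
  have hacute : HullOppositeAnglesAcute S := fun T' hT' i j k hij hik hjk _ => by
    have hmem : ∀ i, ∃ i', T.points i' = T'.points i := fun i => by
      have : T'.points i ∈ Set.range T.points := by rw [hrange]; exact hT'.1 i
      exact this
    choose f hf using hmem
    have hinj : ∀ {i j}, i ≠ j → f i ≠ f j := fun hij he => hij (T'.independent.injective (by
      rw [← hf, ← hf, he]))
    rw [← hf i, ← hf j, ← hf k]
    exact hac _ _ _ (hinj hik) (hinj hij) (hinj hjk.symm)
  choose N hN using exists_isNearest hne
  have hNV' : ∀ x, ∃ p, x ∉ hull S → IsNearest (visibleVertices S x) x p := fun x => by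
    by_cases hx : x ∈ hull S
    · exact ⟨x, fun h => absurd hx h⟩
    · obtain ⟨p, hp⟩ := exists_isNearest_visible hne hx
      exact ⟨p, fun _ => hp⟩
  choose NV hNV using hNV'
  have h1 := integral_cellIntegrand_of_acute hne hacute hN hNV
  rw [integral_cellIntegrand hne hgen hN hNV, sum_edgeTerm_eq_sum_filter] at h1
  have hbody : body T = hull S := by unfold body hull; rw [hrange]
  have hdist : ∀ x, Metric.infDist x (Set.range T.points) = dist x (N x) := fun x => by
    rw [hrange]
    exact le_antisymm (Metric.infDist_le_dist_of_mem (hN x).1)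
      ((Metric.le_infDist ⟨_, (hN x).1⟩).mpr fun {q} hq => (hN x).2 q hq)
  unfold voronoiTriangle
  rw [if_pos hac, hbody]
  simp only [hdist]
  rw [← h1, ← sum_edgeTerm_fiber hD hcoe]
  refine Finset.sum_congr (Finset.filter_congr fun y hy => ?_) fun _ _ => rfl
  refine ⟨fun hy' => ⟨hy', ?_⟩, fun hy' => hy'.1⟩
  have hn := hy'.ne
  refine Finset.eq_of_subset_of_card_le ?_ ?_
  · simp [Finset.insert_subset_iff, hy'.left_mem, hy'.mid_mem, hy'.right_mem]
  · rw [Finset.card_eq_three.mpr ⟨y.1, y.2.1, y.2.2, hn.1.symm, hn.2.1.symm, hn.2.2.symm, rfl⟩]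
    exact Finset.card_le_three

theorem voronoiTriangle_eq {v w u : Plane} (h : 0 < cp v w u) :
    voronoiTriangle (mkTriangle v w u h.ne')
      = edgeTerm v w u + edgeTerm w u v + edgeTerm u v w := by
  by_cases hac : (mkTriangle v w u h.ne').AcuteAngled
  · exact voronoiTriangle_eq_of_acute h hac
  · have hr := range_mkTriangle h.ne'
    unfold voronoiTriangle
    rw [if_neg hac, body, hr, volume_triangle h, (circumcenter_eq h.ne' hr).2, ← closed_formula h,
      dist_sq_eq, dist_sq_eq, dist_sq_eq, dist_sq_eq]
    rfl

theorem voronoiVertexSet_eq {t : Finset Plane} {v w u : Plane} (h : 0 < cp v w u)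
    (ht : (t : Set Plane) = {v, w, u}) :
    voronoiVertexSet t = edgeTerm v w u + edgeTerm w u v + edgeTerm u v w := by
  have hex : ∃ T : Affine.Triangle ℝ Plane, Set.range T.points = (t : Set Plane) :=
    ⟨mkTriangle v w u h.ne', (range_mkTriangle _).trans ht.symm⟩
  unfold voronoiVertexSet
  rw [dif_pos hex, ← voronoiTriangle_eq h]
  exact voronoiTriangle_eq_of_range_eq _ _
    (hex.choose_spec.trans (ht.trans (range_mkTriangle _).symm))

open Classical in
-- Ordered triples are grouped by vertex set; each fibre consists of the three rotations of one
-- triangle.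
theorem voronoi_delaunay (S : Finset Plane) : voronoi (delaunay S)
    = ∑ v ∈ S, ∑ w ∈ S, ∑ u ∈ S with DelaunayTriple S v w u, edgeTerm v w u := by
  rw [sum_edgeTerm_eq_sum_filter, ← Finset.sum_fiberwise_of_maps_to (t := delaunay S)
    (g := fun y : Plane × Plane × Plane => ({y.1, y.2.1, y.2.2} : Finset Plane))]
  · refine Finset.sum_congr rfl fun t ht => ?_
    obtain ⟨v, w, u, hD, hset⟩ := mem_delaunay_iff.mp ht
    rw [voronoiVertexSet_eq hD.pos hset, ← sum_edgeTerm_fiber hD hset, Finset.filter_filter]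
  · intro y hy
    rw [Finset.mem_filter] at hy
    exact mem_delaunay_iff.mpr ⟨_, _, _, hy.2, by simp⟩

end VoronoiFunctional

end

open MeasureTheory VoronoiFunctional in
/-- Here `N x` is a nearest point of `S` to `x`, and, for `x` outside `conv S`, `NV x` is a nearest
visible vertex of `conv S`; both exist. -/
theorem mainTheorem2 (S : Finset Plane) (hne : S.Nonempty) (hgen : GeneralPosition S) :
    (∀ x, ∃ p, IsNearest (S : Set Plane) x p) ∧
    (∀ x, x ∉ hull S → ∃ p, IsNearest (visibleVertices S x) x p) ∧
    ∀ N NV : Plane → Plane,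
      (∀ x, IsNearest (S : Set Plane) x (N x)) →
      (∀ x, x ∉ hull S → IsNearest (visibleVertices S x) x (NV x)) →
        Integrable (cellIntegrand S N NV) volume ∧
        voronoi (delaunay S) = ∫ x, cellIntegrand S N NV x ∧
        (HullOppositeAnglesAcute S →
          voronoi (delaunay S) = ∫ x in hull S, dist x (N x) ^ 2) := by
  refine ⟨exists_isNearest hne, fun x hx => exists_isNearest_visible hne hx,
    fun N NV hN hNV => ?_⟩
  have hV : voronoi (delaunay S) = ∫ x, cellIntegrand S N NV x := by
    rw [voronoi_delaunay, integral_cellIntegrand hne hgen hN hNV]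
  exact ⟨integrable_cellIntegrand hne hgen hN hNV, hV, fun hacute =>
    hV.trans (integral_cellIntegrand_of_acute hne hacute hN hNV)⟩
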